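/- Let $R$ be a (possibly non-commutative) profinite ring with unity and let $(-)^\vee=\mathrm{Hom}_{\mathrm{cts}}(-,\mathbb R/\mathbb Z)$ denote Pontryagin duality between discrete right $R$-modules and profinite left $R$-modules. **Étale spaces.** An étale space of $R$-modules $(\mathcal A,p,X)$ is a local homeomorphism $p:\mathcal A\to X$ to a profinite space $X$, together with right $R$-module structures on the fibres $A_x=p^{-1}(x)$ such that the zero section $X\to\mathcal A$, the addition $\mathcal A\times_X\mathcal A\to\mathcal A$ and the action $\mathcal A\times R\to\mathcal A$ are continuous (so each $A_x$ is a discrete $R$-module). A morphism $(\phi,f):(\mathcal A,p,X)\to(\mathcal B,q,Y)$ consists of continuous maps $f:Y\to X$ and $\phi:\mathcal A\times_XY\to\mathcal B$ such that $\phi$ restricts to $R$-module morphisms $A_{f(y)}\to B_y$ for all $y\in Y$. Write $\mathsf{\acute Etale}\text{-}R$ for this category, and $\Gamma(\mathcal A)$ (the continuous product of $\mathcal A$) for the discrete $R$-module of all continuous global sections $X\to\mathcal A$. **'Sheaves' of profinite modules.** A 'sheaf' of profinite $R$-modules $(\mathcal M,p,X)$ is a continuous surjection $p:\mathcal M\to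 X$ of profinite spaces together with profinite left $R$-module structures on the fibres $M_x=p^{-1}(x)$ such that $R\times\mathcal M\to\mathcal M$ and $\mathcal M\times_X\mathcal M\to\mathcal M$ (action and addition) are continuous. A morphism $(\psi,f):(\mathcal N,q,Y)\to(\mathcal M,p,X)$ consists of continuous maps $\psi:\mathcal N\to\mathcal M$, $f:Y\to X$ with $p\psi=fq$ such that $\psi$ is $R$-linear on fibres. Write $R\text{-}\mathsf{PShf}$ for this category. A profinite direct sum of $\mathcal M$ is a profinite $R$-module $\boxplus\mathcal M$ with a continuous, fibrewise $R$-linear map $\omega:\mathcal M\to\boxplus\mathcal M$ such that every continuous, fibrewise $R$-linear map from $\mathcal M$ to a profinite $R$-module factors through $\omega$ by a unique morphism of profinite $R$-modules. **Dual functors.** For an étale space $\mathcal A$ over $X$ let $\Gamma(U,\mathcal A)$ be the discrete module of continuous sections over the clopen set $U\subseteq X$. The dual 'sheaf' $\widecheck{\mathcal A}$ is the disjoint union over $x\in X$ of the modules $\varprojlim_{U\ni x}\Gamma(U,\mathcal A)^\vee$ ($U$ clopen), with the topology generated by the sets of all points lying over $U$ whose image in $\Gamma(U,\mathcal A)^\vee$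 lies in $W$, for $U$ clopen and $W\subseteq\Gamma(U,\mathcal A)^\vee$ open. For a 'sheaf' $\mathcal M$ over $X$ the dual étale space $\widecheck{\mathcal M}$ is the disjoint union over $x\in X$ of the modules $\varinjlim_{U\ni x}\bigl(\boxplus\,p^{-1}(U)\bigr)^\vee$, with the topology generated by the sets of germs of the elements of $\bigl(\boxplus\,p^{-1}(U)\bigr)^\vee$, $U$ clopen. Both constructions act on morphisms in the evident way. **Theorem.** Every 'sheaf' of profinite $R$-modules has a profinite direct sum, and for every choice of profinite direct sums the following hold. 1. The functors $\widecheck{(-)}:(\mathsf{\acute Etale}\text{-}R)^{\mathrm{op}}\to R\text{-}\mathsf{PShf}$ and $\widecheck{(-)}:R\text{-}\mathsf{PShf}\to(\mathsf{\acute Etale}\text{-}R)^{\mathrm{op}}$ are mutually inverse equivalences of categories. 2. There are isomorphisms of fibres $\widecheck{\mathcal A}_x\cong A_x^\vee$ and $\widecheck{\mathcal M}_x\cong M_x^\vee$ (of profinite, respectively discrete, $R$-modules), natural in morphisms of étale spaces, respectively of 'sheaves'. 3. There are natural isomorphisms $\boxplus\widecheck{\mathcal A}\cong\Gamma(\mathcal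 A)^\vee$ and $\Gamma(\widecheck{\mathcal M})\cong(\boxplus\mathcal M)^\vee$. -/

import Mathlib

open CategoryTheory Opposite TopologicalSpace
open scoped Topology

universe u

noncomputable section

/-! ### Discrete right modules and profinite left modules over a topological ring -/

section Modules

variable (R : Type u) [Ring R] [TopologicalSpace R]

/-- A discrete right `R`-module: an abelian group with a right action of `R` (a left action of
`Rᵐᵒᵖ`), carrying the discrete topology, such that the action is continuous. -/
structure DMod : Type (u + 1) where
  carrier : Type u
  [addCommGroup : AddCommGroup carrier]
  [module : Module Rᵐᵒᵖ carrier]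
  [top : TopologicalSpace carrier]
  [discrete : DiscreteTopology carrier]
  [contSMul : ContinuousSMul Rᵐᵒᵖ carrier]

/-- A profinite left `R`-module: a topological left `R`-module whose underlying space is compact,
Hausdorff and totally disconnected. -/
structure PMod : Type (u + 1) where
  carrier : Type u
  [addCommGroup : AddCommGroup carrier]
  [module : Module R carrier]
  [top : TopologicalSpace carrier]
  [topAddGroup : IsTopologicalAddGroup carrier]
  [compact : CompactSpace carrier]
  [t2 : T2Space carrier]
  [totDisc : TotallyDisconnectedSpace carrier]
  [contSMul : ContinuousSMul R carrier]

end Modules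

attribute [instance] DMod.addCommGroup DMod.module DMod.top DMod.discrete DMod.contSMul
attribute [instance] PMod.addCommGroup PMod.module PMod.top PMod.topAddGroup PMod.compact
  PMod.t2 PMod.totDisc PMod.contSMul

section ModuleCategories

variable {R : Type u} [Ring R] [TopologicalSpace R]

/-- Morphisms of discrete modules are `R`-linear maps (they are automatically continuous). -/
@[ext]
structure DMod.Hom (A B : DMod R) : Type u where
  lin : A.carrier →ₗ[Rᵐᵒᵖ] B.carrier

/-- Morphisms of profinite modules are continuous `R`-linear maps. -/
@[ext]
structure PMod.Hom (M N : PMod R) : Type u where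
  lin : M.carrier →L[R] N.carrier

instance : Category (DMod R) where
  Hom := DMod.Hom
  id A := ⟨LinearMap.id⟩
  comp f g := ⟨g.lin.comp f.lin⟩

instance : Category (PMod R) where
  Hom := PMod.Hom
  id M := ⟨ContinuousLinearMap.id R M.carrier⟩
  comp f g := ⟨g.lin.comp f.lin⟩

/-! ### Pontryagin duality functors, with values in `ℝ / ℤ` -/

/-- `Hom(A, ℝ/ℤ)` for a discrete right module `A`, with the compact-open topology. -/
def DMod.Dual (A : DMod R) : Type u := A.carrier →ₜ+ UnitAddCircle

/-- The group of continuous homomorphisms `M → ℝ/ℤ` for a profinite left module `M`, with the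
compact-open topology. -/
def PMod.Dual (M : PMod R) : Type u := M.carrier →ₜ+ UnitAddCircle

namespace DMod

variable (A : DMod R)

instance : AddCommGroup A.Dual :=
  inferInstanceAs (AddCommGroup (A.carrier →ₜ+ UnitAddCircle))
instance : TopologicalSpace A.Dual :=
  inferInstanceAs (TopologicalSpace (A.carrier →ₜ+ UnitAddCircle))
instance : IsTopologicalAddGroup A.Dual :=
  inferInstanceAs (IsTopologicalAddGroup (A.carrier →ₜ+ UnitAddCircle))
instance : T2Space A.Dual :=
  inferInstanceAs (T2Space (A.carrier →ₜ+ UnitAddCircle))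
instance : CompactSpace A.Dual :=
  inferInstanceAs (CompactSpace (A.carrier →ₜ+ UnitAddCircle))
instance : FunLike A.Dual A.carrier UnitAddCircle :=
  inferInstanceAs (FunLike (A.carrier →ₜ+ UnitAddCircle) A.carrier UnitAddCircle)
instance : AddMonoidHomClass A.Dual A.carrier UnitAddCircle :=
  inferInstanceAs (AddMonoidHomClass (A.carrier →ₜ+ UnitAddCircle) A.carrier UnitAddCircle)
instance : ContinuousMapClass A.Dual A.carrier UnitAddCircle :=
  inferInstanceAs (ContinuousMapClass (A.carrier →ₜ+ UnitAddCircle) A.carrier UnitAddCircle)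
instance : ContinuousEvalConst A.Dual A.carrier UnitAddCircle :=
  inferInstanceAs (ContinuousEvalConst (A.carrier →ₜ+ UnitAddCircle) A.carrier UnitAddCircle)
instance : ContinuousEval A.Dual A.carrier UnitAddCircle :=
  inferInstanceAs (ContinuousEval (A.carrier →ₜ+ UnitAddCircle) A.carrier UnitAddCircle)

variable {A}

@[ext]
theorem Dual.ext {f g : A.Dual} (h : ∀ a, f a = g a) : f = g := DFunLike.ext _ _ h

@[simp]
theorem Dual.add_apply (f g : A.Dual) (a : A.carrier) : (f + g) a = f a + g a := rfl

@[simp]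
theorem Dual.zero_apply (a : A.carrier) : (0 : A.Dual) a = 0 := rfl

/-- The left action of `R` on `Hom(A, ℝ/ℤ)` is `(r • f) a = f (a r)`. -/
instance : SMul R A.Dual where
  smul r f := ContinuousAddMonoidHom.mk
    ((AddMonoidHomClass.toAddMonoidHom f).comp
      (DistribSMul.toAddMonoidHom A.carrier (MulOpposite.op r)))
    continuous_of_discreteTopology

@[simp]
theorem Dual.smul_apply (r : R) (f : A.Dual) (a : A.carrier) :
    (r • f) a = f (MulOpposite.op r • a) := rfl

instance : Module R A.Dual where
  one_smul f := by ext a; simp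
  mul_smul r s f := by ext a; simp [mul_smul]
  smul_zero r := by ext a; simp
  smul_add r f g := by ext a; simp
  add_smul r s f := by ext a; simp [add_smul]
  zero_smul f := by ext a; simp

theorem Dual.continuous_iff {Y : Type*} [TopologicalSpace Y] {F : Y → A.Dual} :
    Continuous F ↔ ∀ a, Continuous fun y => F y a :=
  (ContinuousAddMonoidHom.isClosedEmbedding_coe
    (A := A.carrier) (B := UnitAddCircle)).isInducing.continuous_iff.trans continuous_pi_iff

instance : ContinuousSMul R A.Dual where
  continuous_smul := by
    rw [Dual.continuous_iff]
    intro a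
    have h : Continuous fun p : R × A.Dual => p.2 (MulOpposite.op p.1 • a) := by fun_prop
    exact h

/-- A discrete module over a compact ring is torsion. -/
theorem exists_nsmul_eq_zero [CompactSpace R] (a : A.carrier) :
    ∃ n : ℕ, 0 < n ∧ n • a = 0 := by
  have h : Continuous fun r : R => MulOpposite.op r • a := by fun_prop
  have hf : (Set.range fun r : R => MulOpposite.op r • a).Finite :=
    (isCompact_range h).finite_of_discrete
  have hn : ¬ Function.Injective fun n : ℕ => n • a := by
    intro hi
    refine Set.infinite_range_of_injective hi (hf.subset ?_)
    rintro _ ⟨n, rfl⟩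
    exact ⟨n, by simp [Nat.cast_smul_eq_nsmul]⟩
  rw [Function.Injective] at hn
  push Not at hn
  obtain ⟨m, n, hmn, hne⟩ := hn
  wlog hlt : m < n generalizing m n
  · exact this n m hmn.symm hne.symm (by omega)
  refine ⟨n - m, by omega, ?_⟩
  rw [sub_nsmul _ hlt.le, ← hmn, add_neg_cancel]

instance [CompactSpace R] : TotallyDisconnectedSpace A.Dual where
  isTotallyDisconnected_univ := by
    intro t _ ht f hf g hg
    ext a
    obtain ⟨n, hn, ha⟩ := A.exists_nsmul_eq_zero a
    have hc : Continuous fun f : A.Dual => f a := by fun_prop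
    have himg := ht.image _ hc.continuousOn
    have hfin : ((fun f : A.Dual => f a) '' t).Finite := by
      refine (AddCircle.finite_torsion (1 : ℝ) hn).subset ?_
      rintro _ ⟨f, -, rfl⟩
      simp [← map_nsmul, ha]
    by_contra hne
    exact himg.infinite_of_nontrivial ⟨f a, ⟨f, hf, rfl⟩, g a, ⟨g, hg, rfl⟩, hne⟩ hfin

end DMod

namespace PMod

variable (M : PMod R)

instance : AddCommGroup M.Dual :=
  inferInstanceAs (AddCommGroup (M.carrier →ₜ+ UnitAddCircle))
instance : TopologicalSpace M.Dual :=
  inferInstanceAs (TopologicalSpace (M.carrier →ₜ+ UnitAddCircle))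
instance : IsTopologicalAddGroup M.Dual :=
  inferInstanceAs (IsTopologicalAddGroup (M.carrier →ₜ+ UnitAddCircle))
instance : FunLike M.Dual M.carrier UnitAddCircle :=
  inferInstanceAs (FunLike (M.carrier →ₜ+ UnitAddCircle) M.carrier UnitAddCircle)
instance : AddMonoidHomClass M.Dual M.carrier UnitAddCircle :=
  inferInstanceAs (AddMonoidHomClass (M.carrier →ₜ+ UnitAddCircle) M.carrier UnitAddCircle)
instance : ContinuousMapClass M.Dual M.carrier UnitAddCircle :=
  inferInstanceAs (ContinuousMapClass (M.carrier →ₜ+ UnitAddCircle) M.carrier UnitAddCircle)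
instance : ContinuousEval M.Dual M.carrier UnitAddCircle :=
  inferInstanceAs (ContinuousEval (M.carrier →ₜ+ UnitAddCircle) M.carrier UnitAddCircle)

variable {M}

@[ext]
theorem Dual.ext {f g : M.Dual} (h : ∀ a, f a = g a) : f = g := DFunLike.ext _ _ h

@[simp]
theorem Dual.add_apply (f g : M.Dual) (a : M.carrier) : (f + g) a = f a + g a := rfl

@[simp]
theorem Dual.zero_apply (a : M.carrier) : (0 : M.Dual) a = 0 := rfl

/-- The right action of `R` on `Hom(M, ℝ/ℤ)` is `(f r) m = f (r m)`. -/
instance : SMul Rᵐᵒᵖ M.Dual where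
  smul r f := ContinuousAddMonoidHom.mk
    ((AddMonoidHomClass.toAddMonoidHom f).comp
      (DistribSMul.toAddMonoidHom M.carrier r.unop))
    ((map_continuous f).comp (continuous_const_smul r.unop))

@[simp]
theorem Dual.smul_apply (r : Rᵐᵒᵖ) (f : M.Dual) (a : M.carrier) :
    (r • f) a = f (r.unop • a) := rfl

instance : Module Rᵐᵒᵖ M.Dual where
  one_smul f := by ext a; simp
  mul_smul r s f := by ext a; simp [mul_smul]
  smul_zero r := by ext a; simp
  smul_add r f g := by ext a; simp
  add_smul r s f := by ext a; simp [add_smul]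
  zero_smul f := by ext a; simp

instance : DiscreteTopology M.Dual := by
  let V : Set M.Dual :=
    {ψ | Set.MapsTo ψ Set.univ (AddCircle.toCircle ⁻¹' Circle.centeredArc (Real.pi / 2))}
  have hVopen : IsOpen V := isOpen_induced (ContinuousMap.isOpen_setOfPred_mapsTo isCompact_univ
    ((Circle.isOpen_centeredArc (Real.pi / 2)).preimage AddCircle.continuous_toCircle))
  have hVeq : V = {0} := by
    ext ψ
    rw [Set.mem_singleton_iff]
    refine ⟨fun hψ => ?_, ?_⟩
    · ext a
      apply AddCircle.injective_toCircle (T := 1) one_ne_zero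
      rw [Dual.zero_apply, AddCircle.toCircle_zero]
      refine Circle.eq_one_of_forall_pow_mem_centeredArc_pi_div_two fun n hn => ?_
      have := hψ (Set.mem_univ (n • a))
      rwa [Set.mem_preimage, map_nsmul, AddCircle.toCircle_nsmul] at this
    · rintro rfl _ _
      rw [Set.mem_preimage, Dual.zero_apply, AddCircle.toCircle_zero,
        Circle.mem_centeredArc (by linarith [Real.pi_pos])]
      simp [Real.pi_pos]
  exact discreteTopology_of_isOpen_singleton_zero (by simpa [hVeq] using hVopen)

instance : ContinuousSMul Rᵐᵒᵖ M.Dual where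
  continuous_smul := by
    refine ContinuousAddMonoidHom.continuous_of_continuous_uncurry
      (B := M.carrier) (C := UnitAddCircle) _ ?_
    have h : Continuous fun p : (Rᵐᵒᵖ × M.Dual) × M.carrier =>
      p.1.2 (p.1.1.unop • p.2) := by fun_prop
    exact h

end PMod

/-- Pontryagin duality from discrete right modules to profinite left modules. -/
def dualD [CompactSpace R] : (DMod R)ᵒᵖ ⥤ PMod R where
  obj A := { carrier := A.unop.Dual }
  map {A B} g :=
    { lin :=
        { toFun := fun f => ContinuousAddMonoidHom.mk
            ((AddMonoidHomClass.toAddMonoidHom f).comp g.unop.lin.toAddMonoidHom)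
            continuous_of_discreteTopology
          map_add' := fun _ _ => rfl
          map_smul' := fun r f => DMod.Dual.ext fun a =>
            congrArg f (g.unop.lin.map_smul (MulOpposite.op r) a).symm
          cont := DMod.Dual.continuous_iff.2 fun a =>
            (continuous_eval_const (F := A.unop.Dual) (g.unop.lin a)) } }

/-- Pontryagin duality from profinite left modules to discrete right modules. -/
def dualP : (PMod R)ᵒᵖ ⥤ DMod R where
  obj M := { carrier := M.unop.Dual }
  map {M N} g :=
    { lin :=
        { toFun := fun f => ContinuousAddMonoidHom.mk
            ((AddMonoidHomClass.toAddMonoidHom f).comp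
              (g.unop.lin : N.unop.carrier →ₗ[R] M.unop.carrier).toAddMonoidHom)
            ((map_continuous f).comp g.unop.lin.continuous)
          map_add' := fun _ _ => rfl
          map_smul' := fun r f => PMod.Dual.ext fun a =>
            congrArg f (g.unop.lin.map_smul r.unop a).symm } }

end ModuleCategories

/-! ### Total spaces of families -/

/-- The disjoint union `⨆_{x ∈ X} F x` of a family of sets. It carries no topology by default. -/
@[ext]
structure Tot {X : Type u} (F : X → Type u) : Type u where
  base : X
  val : F base

/-- The topology of the fibre product `E ×_X E`, for `E = Tot F`, where the fibre product is viewed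
as the total space of the family `x ↦ F x × F x`: the subspace topology from `E × E`. -/
abbrev pairTop {X : Type u} (F : X → Type u) [TopologicalSpace (Tot F)] :
    TopologicalSpace (Tot fun x => F x × F x) :=
  TopologicalSpace.induced
    (fun q => ((⟨q.base, q.val.1⟩ : Tot F), (⟨q.base, q.val.2⟩ : Tot F))) inferInstance

/-- The topology of the fibre product `E ×_X Y`, for `E = Tot F` and `f : Y → X`, where the fibre
product is viewed as the total space of `y ↦ F (f y)`: the subspace topology from `E × Y`. -/
abbrev pullbackTop {X Y : Type u} (F : X → Type u) [TopologicalSpace (Tot F)]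
    [TopologicalSpace Y] (f : Y → X) : TopologicalSpace (Tot fun y => F (f y)) :=
  TopologicalSpace.induced
    (fun q => ((⟨f q.base, q.val⟩ : Tot F), q.base)) inferInstance

theorem continuous_pairTop {X : Type u} (F : X → Type u) [TopologicalSpace (Tot F)] :
    Continuous[pairTop F, _]
      fun q => ((⟨q.base, q.val.1⟩ : Tot F), (⟨q.base, q.val.2⟩ : Tot F)) :=
  continuous_induced_dom

theorem continuous_pullbackTop_fst {X Y : Type u} (F : X → Type u) [TopologicalSpace (Tot F)]
    [TopologicalSpace Y] (f : Y → X) :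
    Continuous[pullbackTop F f, _] fun q => (⟨f q.base, q.val⟩ : Tot F) :=
  @Continuous.comp _ _ _ (pullbackTop F f) _ _ _ _ continuous_fst continuous_induced_dom

theorem continuous_pullbackTop_snd {X Y : Type u} (F : X → Type u) [TopologicalSpace (Tot F)]
    [TopologicalSpace Y] (f : Y → X) :
    Continuous[pullbackTop F f, _] fun q => q.base :=
  @Continuous.comp _ _ _ (pullbackTop F f) _ _
    (fun q => ((⟨f q.base, q.val⟩ : Tot F), q.base)) Prod.snd continuous_snd continuous_induced_dom

/-! ### Étale spaces of discrete modules and `sheaves' of profinite modules -/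

section Spaces

variable (R : Type u) [Ring R] [TopologicalSpace R]

/-- An étale space of right `R`-modules over a profinite space: a family of right `R`-modules
together with a topology on its total space such that the projection is a local homeomorphism and
the zero section, the addition and the action of `R` are continuous. (The fibres are then discrete
modules, see `EtaleSpace.fibre`.) -/
structure EtaleSpace : Type (u + 1) where
  base : Profinite.{u}
  fib : base → Type u
  [addCommGroup : ∀ x, AddCommGroup (fib x)]
  [module : ∀ x, Module Rᵐᵒᵖ (fib x)]
  [top : TopologicalSpace (Tot fib)]
  isLocalHomeomorph_proj : IsLocalHomeomorph (Tot.base : Tot fib → base)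
  continuous_zero : Continuous fun x : base => (⟨x, 0⟩ : Tot fib)
  continuous_add : Continuous[pairTop fib, top] fun q => ⟨q.base, q.val.1 + q.val.2⟩
  continuous_smul :
    Continuous fun q : Tot fib × R => (⟨q.1.base, MulOpposite.op q.2 • q.1.val⟩ : Tot fib)

/-- A `sheaf' of profinite left `R`-modules over a profinite space: a family of left `R`-modules
together with a profinite topology on its total space such that the projection, the addition and the
action of `R` are continuous. (The projection is surjective because modules are non-empty, and the
fibres are profinite modules for the subspace topology, see `ProSheaf.fibre`.) -/
structure ProSheaf : Type (u + 1) where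
  base : Profinite.{u}
  fib : base → Type u
  [addCommGroup : ∀ x, AddCommGroup (fib x)]
  [module : ∀ x, Module R (fib x)]
  [top : TopologicalSpace (Tot fib)]
  [compact : CompactSpace (Tot fib)]
  [t2 : T2Space (Tot fib)]
  [totDisc : TotallyDisconnectedSpace (Tot fib)]
  continuous_proj : Continuous (Tot.base : Tot fib → base)
  continuous_add : Continuous[pairTop fib, top] fun q => ⟨q.base, q.val.1 + q.val.2⟩
  continuous_smul :
    Continuous fun q : R × Tot fib => (⟨q.2.base, q.1 • q.2.val⟩ : Tot fib)

end Spaces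

attribute [instance] EtaleSpace.addCommGroup EtaleSpace.module EtaleSpace.top
attribute [instance] ProSheaf.addCommGroup ProSheaf.module ProSheaf.top ProSheaf.compact
  ProSheaf.t2 ProSheaf.totDisc

section SpaceCategories

variable {R : Type u} [Ring R] [TopologicalSpace R]

/-- A morphism `(φ, f) : (A, X) → (B, Y)` of étale spaces of `R`-modules: a continuous map
`f : Y → X` and a continuous map `φ : A ×_X Y → B` restricting to `R`-linear maps
`A_{f y} → B_y`. -/
@[ext]
structure EtaleSpace.Hom (A B : EtaleSpace R) : Type u where
  f : C(B.base, A.base)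
  φ : ∀ y, A.fib (f y) →ₗ[Rᵐᵒᵖ] B.fib y
  continuous_φ : Continuous[pullbackTop A.fib f, B.top] fun q => ⟨q.base, φ q.base q.val⟩

/-- A morphism `(ψ, f) : (N, Y) → (M, X)` of `sheaves' of profinite modules: a continuous map
`f : Y → X` and a continuous map `ψ : N → M` over it restricting to `R`-linear maps
`N_y → M_{f y}`. -/
@[ext]
structure ProSheaf.Hom (N M : ProSheaf R) : Type u where
  f : C(N.base, M.base)
  ψ : ∀ y, N.fib y →ₗ[R] M.fib (f y)
  continuous_ψ : Continuous fun q : Tot N.fib => (⟨f q.base, ψ q.base q.val⟩ : Tot M.fib)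

instance : Category (EtaleSpace R) where
  Hom := EtaleSpace.Hom
  id A :=
    { f := ContinuousMap.id A.base
      φ := fun _ => LinearMap.id
      continuous_φ := continuous_pullbackTop_fst A.fib _ }
  comp {A B C} g h :=
    { f := g.f.comp h.f
      φ := fun z => (h.φ z).comp (g.φ (h.f z))
      continuous_φ := by
        let _ := pullbackTop A.fib (g.f.comp h.f)
        let _ := pullbackTop A.fib g.f
        let _ := pullbackTop B.fib h.f
        have h1 : Continuous fun q : Tot fun z => A.fib (g.f.comp h.f z) =>
            (⟨h.f q.base, q.val⟩ : Tot fun y => A.fib (g.f y)) := by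
          refine continuous_induced_rng.2 (Continuous.prodMk ?_ ?_)
          · exact continuous_pullbackTop_fst A.fib (g.f.comp h.f)
          · exact h.f.continuous.comp (continuous_pullbackTop_snd A.fib (g.f.comp h.f))
        have h2 : Continuous fun q : Tot fun z => A.fib (g.f.comp h.f z) =>
            (⟨q.base, g.φ (h.f q.base) q.val⟩ : Tot fun z => B.fib (h.f z)) := by
          refine continuous_induced_rng.2 (Continuous.prodMk ?_ ?_)
          · exact g.continuous_φ.comp h1
          · exact continuous_pullbackTop_snd A.fib (g.f.comp h.f)
        exact h.continuous_φ.comp h2 }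

instance : Category (ProSheaf R) where
  Hom := ProSheaf.Hom
  id M :=
    { f := ContinuousMap.id M.base
      ψ := fun _ => LinearMap.id
      continuous_ψ := continuous_id }
  comp g h :=
    { f := h.f.comp g.f
      ψ := fun z => (h.ψ (g.f z)).comp (g.ψ z)
      continuous_ψ := h.continuous_ψ.comp g.continuous_ψ }

namespace EtaleSpace

/-- Two points of an étale space that vary continuously over the same point of the base agree on an
open set. -/
theorem isOpen_eqLocus (A : EtaleSpace R) {Y : Type u} [TopologicalSpace Y] {f : Y → A.base}
    {s t : ∀ y, A.fib (f y)} (hs : Continuous fun y => (⟨f y, s y⟩ : Tot A.fib))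
    (ht : Continuous fun y => (⟨f y, t y⟩ : Tot A.fib)) : IsOpen {y | s y = t y} := by
  have h := A.isLocalHomeomorph_proj.isLocallyInjective.isOpen_eqLocus hs ht rfl
  convert h using 3 with y
  simp

/-- The fibre of an étale space of modules over a point, as a discrete `R`-module. -/
def fibre (A : EtaleSpace R) (x : A.base) : DMod R :=
  letI : TopologicalSpace (A.fib x) := ⊥
  haveI : DiscreteTopology (A.fib x) := ⟨rfl⟩
  { carrier := A.fib x
    contSMul := ⟨by
      rw [continuous_prod_of_discrete_right]
      intro a
      have hc : Continuous fun r : R => MulOpposite.op r • a := by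
        rw [continuous_discrete_rng]
        intro b
        have h1 : Continuous fun r : R => (⟨x, MulOpposite.op r • a⟩ : Tot A.fib) :=
          A.continuous_smul.comp
            ((continuous_const (y := (⟨x, a⟩ : Tot A.fib))).prodMk continuous_id)
        exact A.isOpen_eqLocus (f := fun _ => x) (t := fun _ => b) h1 continuous_const
      exact hc.comp MulOpposite.continuous_unop⟩ }

section Lifts

variable (A : EtaleSpace R) {Y : Type u} [TopologicalSpace Y]

/-- The module of continuous lifts `s : Y → A` of a continuous map `f : Y → X`, with pointwise
operations. -/
def liftSubmodule (f : C(Y, A.base)) : Submodule Rᵐᵒᵖ (∀ y, A.fib (f y)) where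
  carrier := {s | Continuous fun y => (⟨f y, s y⟩ : Tot A.fib)}
  add_mem' {s t} hs ht := by
    let _ := pairTop A.fib
    have h : Continuous fun y => (⟨f y, (s y, t y)⟩ : Tot fun x => A.fib x × A.fib x) :=
      continuous_induced_rng.2 (hs.prodMk ht)
    exact A.continuous_add.comp h
  zero_mem' := A.continuous_zero.comp f.continuous
  smul_mem' r s hs := A.continuous_smul.comp (hs.prodMk (continuous_const (y := r.unop)))

/-- The discrete `R`-module of continuous lifts `s : Y → A` of a continuous map `f : Y → X` from a
compact space. -/
def lifts [CompactSpace Y] (f : C(Y, A.base)) : DMod R :=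
  letI : TopologicalSpace (A.liftSubmodule f) := ⊥
  haveI : DiscreteTopology (A.liftSubmodule f) := ⟨rfl⟩
  { carrier := A.liftSubmodule f
    contSMul := ⟨by
      rw [continuous_prod_of_discrete_right]
      intro s
      have hc : Continuous fun r : R => MulOpposite.op r • s := by
        rw [continuous_discrete_rng]
        intro t
        rw [isOpen_iff_forall_mem_open]
        intro r hr
        have h1 : Continuous fun q : Y × R =>
            (⟨f q.1, MulOpposite.op q.2 • s.1 q.1⟩ : Tot A.fib) :=
          A.continuous_smul.comp ((s.2.comp continuous_fst).prodMk continuous_snd)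
        have h2 : Continuous fun q : Y × R => (⟨f q.1, t.1 q.1⟩ : Tot A.fib) :=
          t.2.comp continuous_fst
        have ho := A.isOpen_eqLocus (f := fun q : Y × R => f q.1) h1 h2
        obtain ⟨u, v, -, hv, hu', hv', huv⟩ := generalized_tube_lemma isCompact_univ
          (isCompact_singleton (x := r)) ho (by
            rintro ⟨y, r'⟩ ⟨-, rfl⟩
            exact congrFun (congrArg Subtype.val hr) y)
        refine ⟨v, fun r' hr' => ?_, hv, hv' rfl⟩
        refine Subtype.ext (funext fun y => ?_)
        exact huv (Set.mk_mem_prod (hu' (Set.mem_univ y)) hr')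
      exact hc.comp MulOpposite.continuous_unop⟩ }

end Lifts

/-- The continuous product `∏· A`: the discrete module of global sections of an étale space. -/
def globalSections (A : EtaleSpace R) : DMod R := A.lifts (ContinuousMap.id A.base)

end EtaleSpace

/-- The global sections functor `∏·` from étale spaces of `R`-modules to discrete `R`-modules. -/
def continuousProduct : EtaleSpace R ⥤ DMod R where
  obj A := A.globalSections
  map {A B} g :=
    { lin :=
        { toFun := fun s => ⟨fun y => g.φ y (s.1 (g.f y)), by
            let _ := pullbackTop A.fib g.f
            have h : Continuous fun y => (⟨y, s.1 (g.f y)⟩ : Tot fun y => A.fib (g.f y)) :=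
              continuous_induced_rng.2 ((s.2.comp g.f.continuous).prodMk continuous_id)
            exact g.continuous_φ.comp h⟩
          map_add' := fun s t => Subtype.ext (funext fun y => map_add (g.φ y) _ _)
          map_smul' := fun r s => Subtype.ext (funext fun y => map_smul (g.φ y) r _) } }

end SpaceCategories

section ProSheaves

variable {R : Type u} [Ring R] [TopologicalSpace R]

theorem profinite_of_closed_range {T E : Type u} [TopologicalSpace T] [TopologicalSpace E]
    [CompactSpace E] [T2Space E] [TotallyDisconnectedSpace E] {j : T → E} (hj : Topology.IsInducing j)
    (hinj : Function.Injective j) (hcl : IsClosed (Set.range j)) :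
    CompactSpace T ∧ T2Space T ∧ TotallyDisconnectedSpace T := by
  have h : Topology.IsClosedEmbedding j := ⟨⟨hj, hinj⟩, hcl⟩
  refine ⟨h.compactSpace, h.isEmbedding.t2Space, ⟨?_⟩⟩
  exact h.isEmbedding.isTotallyDisconnected (isTotallyDisconnected_of_totallyDisconnectedSpace _)

namespace ProSheaf

variable (M : ProSheaf R)

/-- The fibre of a `sheaf' of profinite modules over a point, as a profinite module for the subspace
topology. -/
def fibre (x : M.base) : PMod R :=
  letI : TopologicalSpace (M.fib x) :=
    TopologicalSpace.induced (fun m => (⟨x, m⟩ : Tot M.fib)) inferInstance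
  have hmk : Continuous fun m : M.fib x => (⟨x, m⟩ : Tot M.fib) := continuous_induced_dom
  have hp := profinite_of_closed_range (j := fun m : M.fib x => (⟨x, m⟩ : Tot M.fib)) ⟨rfl⟩
    (fun m n h => by simpa using h) (by
      have h : Set.range (fun m : M.fib x => (⟨x, m⟩ : Tot M.fib)) = Tot.base ⁻¹' {x} := by
        ext ⟨y, m⟩
        constructor
        · rintro ⟨n, hn⟩
          exact (congrArg Tot.base hn).symm
        · rintro ⟨⟩
          exact ⟨m, rfl⟩
      rw [h]
      exact isClosed_singleton.preimage M.continuous_proj)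
  haveI := hp.1
  haveI := hp.2.1
  haveI := hp.2.2
  haveI : ContinuousSMul R (M.fib x) := ⟨continuous_induced_rng.2
    (M.continuous_smul.comp (continuous_fst.prodMk (hmk.comp continuous_snd)))⟩
  haveI : IsTopologicalAddGroup (M.fib x) :=
    { continuous_add := by
        let _ := pairTop M.fib
        have h : Continuous fun q : M.fib x × M.fib x =>
            (⟨x, q⟩ : Tot fun x => M.fib x × M.fib x) :=
          continuous_induced_rng.2 ((hmk.comp continuous_fst).prodMk (hmk.comp continuous_snd))
        exact continuous_induced_rng.2 (M.continuous_add.comp h)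
      continuous_neg := by
        have h : Continuous fun m : M.fib x => (-1 : R) • m := continuous_const_smul _
        simpa using h }
  { carrier := M.fib x }

/-- The restriction of a `sheaf' of profinite modules to a clopen subset `U` of the base: the
subspace `p⁻¹(U)` of the total space. -/
def restrict (U : Clopens M.base) : ProSheaf R :=
  haveI : CompactSpace U := isCompact_iff_compactSpace.1 U.isClopen.isClosed.isCompact
  letI j : Tot (fun x : U => M.fib x.1) → Tot M.fib := fun m => ⟨m.base.1, m.val⟩
  letI : TopologicalSpace (Tot fun x : U => M.fib x.1) :=
    TopologicalSpace.induced j inferInstance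
  have hj : Continuous j := continuous_induced_dom
  have hp := profinite_of_closed_range (j := j) ⟨rfl⟩
    (by
      rintro ⟨⟨x, hx⟩, m⟩ ⟨⟨y, hy⟩, n⟩ h
      obtain rfl : x = y := congrArg Tot.base h
      simpa [j] using h)
    (by
      have h : Set.range j = Tot.base ⁻¹' (U : Set M.base) := by
        ext ⟨y, m⟩
        constructor
        · rintro ⟨n, hn⟩
          have hy : n.base.1 = y := congrArg Tot.base hn
          exact hy ▸ n.base.2
        · intro hy
          exact ⟨⟨⟨y, hy⟩, m⟩, rfl⟩
      rw [h]
      exact U.isClopen.isClosed.preimage M.continuous_proj)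
  haveI := hp.1
  haveI := hp.2.1
  haveI := hp.2.2
  { base := Profinite.of U
    fib := fun x => M.fib x.1
    continuous_proj := continuous_induced_rng.2 (M.continuous_proj.comp hj)
    continuous_add := by
      let _ := pairTop M.fib
      let _ := pairTop fun x : U => M.fib x.1
      have h : Continuous fun q : Tot fun x : U => M.fib x.1 × M.fib x.1 =>
          (⟨q.base.1, q.val⟩ : Tot fun x => M.fib x × M.fib x) :=
        continuous_induced_rng.2 ((hj.prodMap hj).comp
          (continuous_pairTop fun x : U => M.fib x.1))
      exact continuous_induced_rng.2 (M.continuous_add.comp h)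
    continuous_smul := continuous_induced_rng.2
      (M.continuous_smul.comp (continuous_fst.prodMk (hj.comp continuous_snd))) }

theorem continuous_restrict_incl (U : Clopens M.base) :
    Continuous fun m : Tot (M.restrict U).fib => (⟨m.base.1, m.val⟩ : Tot M.fib) :=
  continuous_induced_dom

variable {M}

/-- The restriction `p⁻¹(V) → p⁻¹(U)` of a morphism of `sheaves' over a map sending `V` into `U`. -/
def restrictMap {N : ProSheaf R} (g : N ⟶ M) (V : Clopens N.base) (U : Clopens M.base)
    (h : ∀ y ∈ V, g.f y ∈ U) : N.restrict V ⟶ M.restrict U where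
  f := ⟨fun y => ⟨g.f y.1, h y.1 y.2⟩,
    (g.f.continuous.comp continuous_subtype_val).subtype_mk _⟩
  ψ y := g.ψ y.1
  continuous_ψ := continuous_induced_rng.2 (g.continuous_ψ.comp (N.continuous_restrict_incl V))

variable (M)

/-- A morphism from a `sheaf' of profinite modules to a profinite module `P`: a continuous map from
the total space to `P` whose restriction to each fibre is `R`-linear. -/
@[ext]
structure MapTo (P : PMod R) : Type u where
  toFun : ∀ x, M.fib x →ₗ[R] P.carrier
  continuous_toFun : Continuous fun m : Tot M.fib => toFun m.base m.val

variable {M}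

/-- Composition of a map from a `sheaf' to a module with a morphism of modules. -/
def MapTo.comp {P Q : PMod R} (b : M.MapTo P) (g : P ⟶ Q) : M.MapTo Q where
  toFun x := (g.lin : P.carrier →ₗ[R] Q.carrier).comp (b.toFun x)
  continuous_toFun := g.lin.continuous.comp b.continuous_toFun

/-- Composition of a morphism of `sheaves' with a map from a `sheaf' to a module. -/
def MapTo.precomp {N : ProSheaf R} {P : PMod R} (g : N ⟶ M) (b : M.MapTo P) : N.MapTo P where
  toFun y := (b.toFun (g.f y)).comp (g.ψ y)
  continuous_toFun := b.continuous_toFun.comp g.continuous_ψ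

variable (M)

/-- A profinite direct sum of a `sheaf' `M` of profinite modules: a profinite module with a
universal map from `M`. -/
structure ProfiniteSum : Type (u + 1) where
  sum : PMod R
  ω : M.MapTo sum
  universal : ∀ (P : PMod R) (b : M.MapTo P), ∃! g : sum ⟶ P, ω.comp g = b

variable {M}

/-- The morphism out of a profinite direct sum induced by its universal property. -/
def ProfiniteSum.desc (S : M.ProfiniteSum) {P : PMod R} (b : M.MapTo P) : S.sum ⟶ P :=
  (S.universal P b).choose

theorem ProfiniteSum.comp_desc (S : M.ProfiniteSum) {P : PMod R} (b : M.MapTo P) :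
    S.ω.comp (S.desc b) = b := (S.universal P b).choose_spec.1

theorem ProfiniteSum.hom_ext (S : M.ProfiniteSum) {P : PMod R} {g h : S.sum ⟶ P}
    (H : S.ω.comp g = S.ω.comp h) : g = h := (S.universal P _).unique H rfl

end ProSheaf

/-- A choice of profinite direct sums makes `⊞` a functor from `sheaves' of profinite modules to
profinite modules. -/
def profiniteDirectSum (S : ∀ M : ProSheaf R, M.ProfiniteSum) : ProSheaf R ⥤ PMod R where
  obj M := (S M).sum
  map {N M} g := (S N).desc (ProSheaf.MapTo.precomp g (S M).ω)
  map_id M := (S M).hom_ext ((S M).comp_desc _)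
  map_comp {L N M} g h := (S L).hom_ext (by
    rw [ProSheaf.ProfiniteSum.comp_desc]
    change _ = ((S L).ω.comp _).comp _
    rw [ProSheaf.ProfiniteSum.comp_desc]
    change _ = ProSheaf.MapTo.precomp g ((S N).ω.comp _)
    rw [ProSheaf.ProfiniteSum.comp_desc]
    rfl)

end ProSheaves

/-! ### Presheaves of discrete modules and precosheaves of profinite modules -/

/-- The preimage of a clopen set under a continuous map. -/
def clopenPreimage {X Y : Type u} [TopologicalSpace X] [TopologicalSpace Y] (f : C(Y, X))
    (U : Clopens X) : Clopens Y := ⟨f ⁻¹' U, U.isClopen.preimage f.continuous⟩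

theorem clopenPreimage_inf_mono {X Y : Type u} [TopologicalSpace X] [TopologicalSpace Y]
    (f : C(Y, X)) {U U' : Clopens X} {V V' : Clopens Y} (h : U' ≤ U) (k : V' ≤ V) :
    clopenPreimage f U' ⊓ V' ≤ clopenPreimage f U ⊓ V := fun _ hy => ⟨h hy.1, k hy.2⟩

theorem clopenPreimage_id_inf_le {X : Type u} [TopologicalSpace X] (U V : Clopens X) :
    clopenPreimage (ContinuousMap.id X) U ⊓ V ≤ U := fun _ hy => hy.1

theorem clopenPreimage_comp_inf_le {X Y Z : Type u} [TopologicalSpace X] [TopologicalSpace Y]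
    [TopologicalSpace Z] (f : C(Y, X)) (g : C(Z, Y)) (U : Clopens X) (W : Clopens Z) :
    clopenPreimage (f.comp g) U ⊓ W ≤ clopenPreimage g (clopenPreimage f U ⊓ ⊤) ⊓ W :=
  fun _ hz => ⟨⟨hz.1, trivial⟩, hz.2⟩

section Presheaves

variable (R : Type u) [Ring R] [TopologicalSpace R]

/-- A presheaf of discrete right `R`-modules on the clopen subsets of a profinite space. -/
structure DPresheaf : Type (u + 1) where
  base : Profinite.{u}
  sh : (Clopens base)ᵒᵖ ⥤ DMod R

/-- A precosheaf of profinite left `R`-modules on the clopen subsets of a profinite space. -/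
structure PPrecosheaf : Type (u + 1) where
  base : Profinite.{u}
  cosh : Clopens base ⥤ PMod R

end Presheaves

section PresheafCategories

variable {R : Type u} [Ring R] [TopologicalSpace R]

/-- The restriction maps of a presheaf. -/
def DPresheaf.res (A : DPresheaf R) {U V : Clopens A.base} (h : U ≤ V) :
    A.sh.obj (op V) ⟶ A.sh.obj (op U) := A.sh.map (homOfLE h).op

/-- The corestriction maps of a precosheaf. -/
def PPrecosheaf.cor (M : PPrecosheaf R) {U V : Clopens M.base} (h : U ≤ V) :
    M.cosh.obj U ⟶ M.cosh.obj V := M.cosh.map (homOfLE h)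

theorem DPresheaf.res_refl (A : DPresheaf R) {U : Clopens A.base} (h : U ≤ U) :
    A.res h = 𝟙 _ := A.sh.map_id _

theorem DPresheaf.res_res (A : DPresheaf R) {U V W : Clopens A.base} (h : U ≤ V) (k : V ≤ W) :
    A.res k ≫ A.res h = A.res (h.trans k) := (A.sh.map_comp _ _).symm

theorem PPrecosheaf.cor_refl (M : PPrecosheaf R) {U : Clopens M.base} (h : U ≤ U) :
    M.cor h = 𝟙 _ := M.cosh.map_id _

theorem PPrecosheaf.cor_cor (M : PPrecosheaf R) {U V W : Clopens M.base} (h : U ≤ V)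
    (k : V ≤ W) : M.cor h ≫ M.cor k = M.cor (h.trans k) := (M.cosh.map_comp _ _).symm

theorem PPrecosheaf.cor_cor_assoc (M : PPrecosheaf R) {U V W : Clopens M.base} (h : U ≤ V)
    (k : V ≤ W) {P : PMod R} (l : M.cosh.obj W ⟶ P) :
    M.cor h ≫ M.cor k ≫ l = M.cor (h.trans k) ≫ l := by
  rw [← Category.assoc, M.cor_cor]

/-- A morphism `(Φ, f) : (A, X) → (B, Y)` of presheaves: a continuous map `f : Y → X` and maps
`Φ_{U,V} : A(U) → B(f⁻¹(U) ∩ V)`, natural in the clopen sets `U ⊆ X` and `V ⊆ Y`. -/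
@[ext]
structure DPresheaf.Hom (A B : DPresheaf R) : Type u where
  f : C(B.base, A.base)
  app : ∀ (U : Clopens A.base) (V : Clopens B.base),
    A.sh.obj (op U) ⟶ B.sh.obj (op (clopenPreimage f U ⊓ V))
  naturality : ∀ {U U' : Clopens A.base} {V V' : Clopens B.base} (h : U' ≤ U) (k : V' ≤ V),
    A.res h ≫ app U' V' =
      app U V ≫ B.res (clopenPreimage_inf_mono f h k)

/-- A morphism `(Ψ, f) : (N, Y) → (M, X)` of precosheaves: a continuous map `f : Y → X` and maps
`Ψ_{U,V} : N(f⁻¹(U) ∩ V) → M(U)`, natural in the clopen sets `U ⊆ X` and `V ⊆ Y`. -/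
@[ext]
structure PPrecosheaf.Hom (N M : PPrecosheaf R) : Type u where
  f : C(N.base, M.base)
  app : ∀ (U : Clopens M.base) (V : Clopens N.base),
    N.cosh.obj (clopenPreimage f U ⊓ V) ⟶ M.cosh.obj U
  naturality : ∀ {U U' : Clopens M.base} {V V' : Clopens N.base} (h : U' ≤ U) (k : V' ≤ V),
    N.cor (clopenPreimage_inf_mono f h k) ≫ app U V =
      app U' V' ≫ M.cor h

theorem DPresheaf.Hom.naturality_assoc {A B : DPresheaf R} (Φ : DPresheaf.Hom A B)
    {U U' : Clopens A.base} {V V' : Clopens B.base} (h : U' ≤ U) (k : V' ≤ V) {P : DMod R}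
    (l : B.sh.obj (op (clopenPreimage Φ.f U' ⊓ V')) ⟶ P) :
    A.res h ≫ Φ.app U' V' ≫ l =
      Φ.app U V ≫ B.res (clopenPreimage_inf_mono Φ.f h k) ≫ l := by
  rw [← Category.assoc, Φ.naturality h k, Category.assoc]

theorem PPrecosheaf.Hom.naturality_assoc {N M : PPrecosheaf R} (Ψ : PPrecosheaf.Hom N M)
    {U U' : Clopens M.base} {V V' : Clopens N.base} (h : U' ≤ U) (k : V' ≤ V) {P : PMod R}
    (l : M.cosh.obj U ⟶ P) :
    N.cor (clopenPreimage_inf_mono Ψ.f h k) ≫ Ψ.app U V ≫ l =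
      Ψ.app U' V' ≫ M.cor h ≫ l := by
  rw [← Category.assoc, Ψ.naturality h k, Category.assoc]

/-- The identity of a presheaf. -/
def DPresheaf.Hom.id (A : DPresheaf R) : DPresheaf.Hom A A where
  f := ContinuousMap.id A.base
  app U V := A.res (clopenPreimage_id_inf_le U V)
  naturality h k := by rw [DPresheaf.res_res, DPresheaf.res_res]

/-- Composition of morphisms of presheaves: `(Ψ ∘ Φ)_{U,W} = Ψ_{f⁻¹(U),W} ∘ Φ_{U,Y}`. -/
def DPresheaf.Hom.comp {A B C : DPresheaf R} (Φ : DPresheaf.Hom A B) (Ψ : DPresheaf.Hom B C) :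
    DPresheaf.Hom A C where
  f := Φ.f.comp Ψ.f
  app U W := Φ.app U ⊤ ≫ Ψ.app (clopenPreimage Φ.f U ⊓ ⊤) W ≫
    C.res (clopenPreimage_comp_inf_le Φ.f Ψ.f U W)
  naturality h k := by
    simp only [Category.assoc]
    rw [Φ.naturality_assoc h le_rfl, Ψ.naturality_assoc _ k, DPresheaf.res_res,
      DPresheaf.res_res]

/-- The identity of a precosheaf. -/
def PPrecosheaf.Hom.id (M : PPrecosheaf R) : PPrecosheaf.Hom M M where
  f := ContinuousMap.id M.base
  app U V := M.cor (clopenPreimage_id_inf_le U V)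
  naturality h k := by rw [PPrecosheaf.cor_cor, PPrecosheaf.cor_cor]

/-- Composition of morphisms of precosheaves: `(Ψ' ∘ Ψ)_{U,W} = Ψ'_{U,Y} ∘ Ψ_{f⁻¹(U),W}`. -/
def PPrecosheaf.Hom.comp {L N M : PPrecosheaf R} (Ψ : PPrecosheaf.Hom L N)
    (Ψ' : PPrecosheaf.Hom N M) : PPrecosheaf.Hom L M where
  f := Ψ'.f.comp Ψ.f
  app U W := L.cor (clopenPreimage_comp_inf_le Ψ'.f Ψ.f U W) ≫
    Ψ.app (clopenPreimage Ψ'.f U ⊓ ⊤) W ≫ Ψ'.app U ⊤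
  naturality h k := by
    simp only [Category.assoc]
    rw [← Ψ'.naturality h le_rfl, ← Ψ.naturality_assoc _ k]
    simp only [PPrecosheaf.cor_cor_assoc]

theorem DPresheaf.Hom.id_comp {A B : DPresheaf R} (Φ : DPresheaf.Hom A B) :
    (DPresheaf.Hom.id A).comp Φ = Φ := by
  refine DPresheaf.Hom.ext rfl (heq_of_eq ?_)
  funext U V
  refine (Φ.naturality_assoc (clopenPreimage_id_inf_le U ⊤) (le_refl V) _).trans ?_
  exact (congrArg (Φ.app U V ≫ ·) ((B.res_res _ _).trans (B.res_refl _))).trans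
    (Category.comp_id _)

theorem DPresheaf.Hom.comp_id {A B : DPresheaf R} (Φ : DPresheaf.Hom A B) :
    Φ.comp (DPresheaf.Hom.id B) = Φ := by
  refine DPresheaf.Hom.ext rfl (heq_of_eq ?_)
  funext U V
  have h := Φ.naturality (le_refl U) (le_top : V ≤ ⊤)
  rw [DPresheaf.res_refl, Category.id_comp] at h
  exact (congrArg (Φ.app U ⊤ ≫ ·) (B.res_res _ _)).trans h.symm

theorem DPresheaf.Hom.assoc {A B C D : DPresheaf R} (Φ : DPresheaf.Hom A B)
    (Ψ : DPresheaf.Hom B C) (Θ : DPresheaf.Hom C D) :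
    (Φ.comp Ψ).comp Θ = Φ.comp (Ψ.comp Θ) := by
  refine DPresheaf.Hom.ext rfl (heq_of_eq ?_)
  funext U V
  have h := Θ.naturality_assoc (clopenPreimage_comp_inf_le Φ.f Ψ.f U ⊤) (le_refl V)
    (D.res (clopenPreimage_comp_inf_le (Φ.f.comp Ψ.f) Θ.f U V))
  rw [DPresheaf.res_res] at h
  simp only [DPresheaf.Hom.comp, Category.assoc]
  refine congrArg (Φ.app U ⊤ ≫ Ψ.app (clopenPreimage Φ.f U ⊓ ⊤) ⊤ ≫ ·) (h.trans ?_)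
  exact congrArg (Θ.app _ V ≫ ·) (D.res_res _ _).symm

theorem PPrecosheaf.Hom.id_comp {N M : PPrecosheaf R} (Ψ : PPrecosheaf.Hom N M) :
    (PPrecosheaf.Hom.id N).comp Ψ = Ψ := by
  refine PPrecosheaf.Hom.ext rfl (heq_of_eq ?_)
  funext U V
  have h := Ψ.naturality (le_refl U) (le_top : V ≤ ⊤)
  rw [PPrecosheaf.cor_refl, Category.comp_id] at h
  refine ((Category.assoc _ _ _).symm.trans ?_).trans h
  exact congrArg (· ≫ Ψ.app U ⊤) (N.cor_cor _ _)

theorem PPrecosheaf.Hom.comp_id {N M : PPrecosheaf R} (Ψ : PPrecosheaf.Hom N M) :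
    Ψ.comp (PPrecosheaf.Hom.id M) = Ψ := by
  refine PPrecosheaf.Hom.ext rfl (heq_of_eq ?_)
  funext U V
  have h := Ψ.naturality (clopenPreimage_id_inf_le U ⊤) (le_refl V)
  refine (congrArg (N.cor (clopenPreimage_comp_inf_le (ContinuousMap.id _) Ψ.f U V) ≫ ·)
    h.symm).trans ?_
  refine (Category.assoc _ _ _).symm.trans ?_
  exact (congrArg (· ≫ Ψ.app U V) ((N.cor_cor _ _).trans (N.cor_refl _))).trans
    (Category.id_comp _)

theorem PPrecosheaf.Hom.assoc {K L N M : PPrecosheaf R} (Φ : PPrecosheaf.Hom K L)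
    (Ψ : PPrecosheaf.Hom L N) (Θ : PPrecosheaf.Hom N M) :
    (Φ.comp Ψ).comp Θ = Φ.comp (Ψ.comp Θ) := by
  refine PPrecosheaf.Hom.ext rfl (heq_of_eq ?_)
  funext U V
  have h := Φ.naturality_assoc (clopenPreimage_comp_inf_le Θ.f Ψ.f U ⊤) (le_refl V)
    (Ψ.app (clopenPreimage Θ.f U ⊓ ⊤) ⊤ ≫ Θ.app U ⊤)
  have h' := congrArg (K.cor (clopenPreimage_comp_inf_le (Θ.f.comp Ψ.f) Φ.f U V) ≫ ·) h
  simp only [PPrecosheaf.cor_cor_assoc] at h'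
  simp only [PPrecosheaf.Hom.comp, Category.assoc]
  refine Eq.trans ?_ h'
  refine (Category.assoc _ _ _).symm.trans ?_
  exact congrArg (· ≫ Φ.app _ V ≫ Ψ.app _ ⊤ ≫ Θ.app U ⊤) (K.cor_cor _ _)

instance : Category (DPresheaf R) where
  Hom := DPresheaf.Hom
  id := DPresheaf.Hom.id
  comp := DPresheaf.Hom.comp
  id_comp := DPresheaf.Hom.id_comp
  comp_id := DPresheaf.Hom.comp_id
  assoc := DPresheaf.Hom.assoc

instance : Category (PPrecosheaf R) where
  Hom := PPrecosheaf.Hom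
  id := PPrecosheaf.Hom.id
  comp := PPrecosheaf.Hom.comp
  id_comp := PPrecosheaf.Hom.id_comp
  comp_id := PPrecosheaf.Hom.comp_id
  assoc := PPrecosheaf.Hom.assoc

/-- The precosheaf `A^∨`, `U ↦ A(U)^∨`. -/
def dualPresheaf [CompactSpace R] : (DPresheaf R)ᵒᵖ ⥤ PPrecosheaf R where
  obj A := { base := A.unop.base, cosh := A.unop.sh.rightOp ⋙ dualD }
  map {A B} Φ :=
    { f := Φ.unop.f
      app := fun U V => dualD.map (Φ.unop.app U V).op
      naturality := fun h k => by
        have := congrArg (fun g => dualD.map g.op) (Φ.unop.naturality h k)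
        exact this.symm }
  map_id A := rfl
  map_comp Φ Ψ := rfl

/-- The presheaf `M^∨`, `U ↦ M(U)^∨`. -/
def dualPrecosheaf : (PPrecosheaf R)ᵒᵖ ⥤ DPresheaf R where
  obj M := { base := M.unop.base, sh := M.unop.cosh.op ⋙ dualP }
  map {M N} Ψ :=
    { f := Ψ.unop.f
      app := fun U V => dualP.map (Ψ.unop.app U V).op
      naturality := fun h k => by
        have := congrArg (fun g => dualP.map g.op) (Ψ.unop.naturality h k)
        exact this.symm }
  map_id M := rfl
  map_comp Φ Ψ := rfl

/-! ### From spaces to (co)sheaves -/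

/-- The inclusion of a clopen subset. -/
def clopenIncl {X : Type u} [TopologicalSpace X] (U : Clopens X) : C(U, X) :=
  ⟨Subtype.val, continuous_subtype_val⟩

instance {X : Type u} [TopologicalSpace X] [CompactSpace X] (U : Clopens X) : CompactSpace U :=
  isCompact_iff_compactSpace.1 U.isClopen.isClosed.isCompact

/-- The map from the sections of `A` over `U` to the sections of `B` over `V`, `s ↦ φ(s(f y), y)`,
induced by a morphism `(φ, f)` of étale spaces such that `f` sends `V` into `U`. -/
def sectionMap {A B : EtaleSpace R} (g : A ⟶ B) (V : Clopens B.base) (U : Clopens A.base)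
    (h : ∀ y ∈ V, g.f y ∈ U) : A.lifts (clopenIncl U) ⟶ B.lifts (clopenIncl V) where
  lin :=
    { toFun := fun s => ⟨fun y => g.φ y.1 (s.1 ⟨g.f y.1, h y.1 y.2⟩), by
        let _ := pullbackTop A.fib g.f
        have h0 : Continuous fun y : V => (⟨g.f y.1, s.1 ⟨g.f y.1, h y.1 y.2⟩⟩ : Tot A.fib) :=
          s.2.comp ((g.f.continuous.comp continuous_subtype_val).subtype_mk fun y => h y.1 y.2)
        have h1 : Continuous fun y : V =>
            (⟨y.1, s.1 ⟨g.f y.1, h y.1 y.2⟩⟩ : Tot fun y => A.fib (g.f y)) :=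
          continuous_induced_rng.2 (h0.prodMk continuous_subtype_val)
        exact g.continuous_φ.comp h1⟩
      map_add' := fun s t => Subtype.ext (funext fun y => map_add (g.φ y.1) _ _)
      map_smul' := fun r s => Subtype.ext (funext fun y => map_smul (g.φ y.1) r _) }

theorem sectionMap_id (A : EtaleSpace R) (U : Clopens A.base)
    (h : ∀ y ∈ U, (𝟙 A : A ⟶ A).f y ∈ U) : sectionMap (𝟙 A) U U h = 𝟙 _ := rfl

theorem sectionMap_comp {A B C : EtaleSpace R} (g : A ⟶ B) (h : B ⟶ C)
    (W : Clopens C.base) (V : Clopens B.base) (U : Clopens A.base) (hg : ∀ y ∈ V, g.f y ∈ U)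
    (hh : ∀ y ∈ W, h.f y ∈ V) (hgh : ∀ y ∈ W, (g ≫ h).f y ∈ U) :
    sectionMap g V U hg ≫ sectionMap h W V hh = sectionMap (g ≫ h) W U hgh := rfl

/-- The sheaf of an étale space: its value at a clopen set `U` is the discrete module of continuous
sections over `U`. -/
def Shf : EtaleSpace R ⥤ DPresheaf R where
  obj A :=
    { base := A.base
      sh :=
        { obj := fun U => A.lifts (clopenIncl U.unop)
          map := fun {U V} i => sectionMap (𝟙 A) V.unop U.unop fun _ hx => leOfHom i.unop hx
          map_id := fun U => sectionMap_id A U.unop _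
          map_comp := fun {U V W} i j => (sectionMap_comp (𝟙 A) (𝟙 A) W.unop V.unop U.unop
            (fun _ hx => leOfHom i.unop hx) (fun _ hx => leOfHom j.unop hx)
            (fun _ hx => leOfHom i.unop (leOfHom j.unop hx))).symm } }
  map {A B} g :=
    { f := g.f
      app := fun U V => sectionMap g (clopenPreimage g.f U ⊓ V) U fun _ hy => hy.1
      naturality := fun {U U' V V'} h k =>
        (sectionMap_comp (𝟙 A) g (clopenPreimage g.f U' ⊓ V') U' U (fun _ hx => h hx)
          (fun _ hy => hy.1) (fun _ hy => h hy.1)).trans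
        (sectionMap_comp g (𝟙 B) (clopenPreimage g.f U' ⊓ V') (clopenPreimage g.f U ⊓ V) U
          (fun _ hy => hy.1) (fun _ hy => ⟨h hy.1, k hy.2⟩) (fun _ hy => h hy.1)).symm }
  map_id A := rfl
  map_comp {A B C} g h := DPresheaf.Hom.ext rfl (heq_of_eq (funext fun U => funext fun W =>
    ((congrArg (sectionMap g (clopenPreimage g.f U ⊓ ⊤) U (fun _ hy => hy.1) ≫ ·)
      (sectionMap_comp h (𝟙 C)
        (clopenPreimage (g.f.comp h.f) U ⊓ W) (clopenPreimage h.f (clopenPreimage g.f U ⊓ ⊤) ⊓ W)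
        (clopenPreimage g.f U ⊓ ⊤) (fun _ hy => hy.1) (fun _ hy => ⟨⟨hy.1, trivial⟩, hy.2⟩)
        (fun _ hy => ⟨hy.1, trivial⟩))).trans
      (sectionMap_comp g h (clopenPreimage (g.f.comp h.f) U ⊓ W) (clopenPreimage g.f U ⊓ ⊤) U
        (fun _ hy => hy.1) (fun _ hy => ⟨hy.1, trivial⟩) (fun _ hy => hy.1))).symm))

theorem ProSheaf.restrictMap_comp {L N M : ProSheaf R} (g : L ⟶ N) (h : N ⟶ M)
    (W : Clopens L.base) (V : Clopens N.base) (U : Clopens M.base) (hg : ∀ y ∈ W, g.f y ∈ V)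
    (hh : ∀ y ∈ V, h.f y ∈ U) (hgh : ∀ y ∈ W, (g ≫ h).f y ∈ U) :
    restrictMap g W V hg ≫ restrictMap h V U hh = restrictMap (g ≫ h) W U hgh := rfl

/-- The morphism `⊞_{y ∈ V} N_y → ⊞_{x ∈ U} M_x` induced by a morphism of `sheaves' over a map
sending `V` into `U`. -/
def sumMap (S : ∀ M : ProSheaf R, M.ProfiniteSum) {N M : ProSheaf R} (g : N ⟶ M)
    (V : Clopens N.base) (U : Clopens M.base) (h : ∀ y ∈ V, g.f y ∈ U) :
    (profiniteDirectSum S).obj (N.restrict V) ⟶ (profiniteDirectSum S).obj (M.restrict U) :=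
  (profiniteDirectSum S).map (ProSheaf.restrictMap g V U h)

theorem sumMap_id (S : ∀ M : ProSheaf R, M.ProfiniteSum) (M : ProSheaf R) (U : Clopens M.base)
    (h : ∀ y ∈ U, (𝟙 M : M ⟶ M).f y ∈ U) : sumMap S (𝟙 M) U U h = 𝟙 _ :=
  (profiniteDirectSum S).map_id (M.restrict U)

theorem sumMap_comp (S : ∀ M : ProSheaf R, M.ProfiniteSum) {L N M : ProSheaf R} (g : L ⟶ N)
    (h : N ⟶ M) (W : Clopens L.base) (V : Clopens N.base) (U : Clopens M.base)
    (hg : ∀ y ∈ W, g.f y ∈ V) (hh : ∀ y ∈ V, h.f y ∈ U) (hgh : ∀ y ∈ W, (g ≫ h).f y ∈ U) :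
    sumMap S g W V hg ≫ sumMap S h V U hh = sumMap S (g ≫ h) W U hgh :=
  ((profiniteDirectSum S).map_comp _ _).symm

/-- The cosheaf of a `sheaf' of profinite modules: its value at a clopen set `U` is the (chosen)
profinite direct sum of the restriction to `U`. -/
def CoShf (S : ∀ M : ProSheaf R, M.ProfiniteSum) : ProSheaf R ⥤ PPrecosheaf R where
  obj M :=
    { base := M.base
      cosh :=
        { obj := fun U => (profiniteDirectSum S).obj (M.restrict U)
          map := fun {U V} i => sumMap S (𝟙 M) U V fun _ hx => leOfHom i hx
          map_id := fun U => sumMap_id S M U _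
          map_comp := fun i j => (sumMap_comp S (𝟙 M) (𝟙 M) _ _ _ _ _ _).symm } }
  map {N M} g :=
    { f := g.f
      app := fun U V => sumMap S g (clopenPreimage g.f U ⊓ V) U fun _ hy => hy.1
      naturality := fun {U U' V V'} h k =>
        (sumMap_comp S (𝟙 N) g (clopenPreimage g.f U' ⊓ V') (clopenPreimage g.f U ⊓ V) U
          (fun _ hy => ⟨h hy.1, k hy.2⟩) (fun _ hy => hy.1) (fun _ hy => h hy.1)).trans
        (sumMap_comp S g (𝟙 M) (clopenPreimage g.f U' ⊓ V') U' U
          (fun _ hy => hy.1) (fun _ hx => h hx) (fun _ hy => h hy.1)).symm }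
  map_id M := rfl
  map_comp {L N M} g h := PPrecosheaf.Hom.ext rfl (heq_of_eq (funext fun U => funext fun W =>
    ((congrArg (sumMap S (𝟙 L) (clopenPreimage (h.f.comp g.f) U ⊓ W)
        (clopenPreimage g.f (clopenPreimage h.f U ⊓ ⊤) ⊓ W)
        (fun _ hy => ⟨⟨hy.1, trivial⟩, hy.2⟩) ≫ ·)
      (sumMap_comp S g h (clopenPreimage g.f (clopenPreimage h.f U ⊓ ⊤) ⊓ W)
        (clopenPreimage h.f U ⊓ ⊤) U (fun _ hy => hy.1) (fun _ hy => hy.1)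
        (fun _ hy => hy.1.1))).trans
      (sumMap_comp S (𝟙 L) (g ≫ h) (clopenPreimage (h.f.comp g.f) U ⊓ W)
        (clopenPreimage g.f (clopenPreimage h.f U ⊓ ⊤) ⊓ W) U
        (fun _ hy => ⟨⟨hy.1, trivial⟩, hy.2⟩) (fun _ hy => hy.1.1) (fun _ hy => hy.1))).symm))

end PresheafCategories

/-! ### The étale space of a presheaf -/

section EtaleFunctor

variable {R : Type u} [Ring R] [TopologicalSpace R]

namespace DPresheaf

variable (A : DPresheaf R)

/-- The clopen neighbourhoods of a point, ordered by reverse inclusion. -/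
abbrev Nbhd (x : A.base) : Type u := {U : Clopens A.base // x ∈ U}ᵒᵈ

instance (x : A.base) : Nonempty (A.Nbhd x) := ⟨OrderDual.toDual ⟨⊤, trivial⟩⟩

instance (x : A.base) : IsDirectedOrder (A.Nbhd x) :=
  ⟨fun U V => ⟨OrderDual.toDual ⟨(OrderDual.ofDual U).1 ⊓ (OrderDual.ofDual V).1,
    ⟨(OrderDual.ofDual U).2, (OrderDual.ofDual V).2⟩⟩,
    fun _ h => h.1, fun _ h => h.2⟩⟩

/-- The directed system of the sections of a presheaf over the clopen neighbourhoods of `x`. -/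
abbrev nbhdObj (x : A.base) (U : A.Nbhd x) : Type u :=
  (A.sh.obj (op (OrderDual.ofDual U).1)).carrier

/-- The transition maps of the directed system `nbhdObj`. -/
abbrev nbhdMap (x : A.base) (U V : A.Nbhd x) (h : U ≤ V) : A.nbhdObj x U →ₗ[Rᵐᵒᵖ] A.nbhdObj x V :=
  (A.res (show (OrderDual.ofDual V).1 ≤ (OrderDual.ofDual U).1 from h)).lin

instance (x : A.base) : DirectedSystem (A.nbhdObj x) (A.nbhdMap x · · ·) where
  map_self U a := by
    change (A.res _).lin a = a
    rw [A.res_refl]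
    rfl
  map_map U V W h k a := by
    change ((A.res _) ≫ (A.res _)).lin a = (A.res _).lin a
    rw [A.res_res]

open Classical in
/-- The stalk `colim_{U ∋ x} A(U)` of a presheaf. -/
def stalk (x : A.base) : Type u := Module.DirectLimit (A.nbhdObj x) (A.nbhdMap x)

open Classical in
instance (x : A.base) : AddCommGroup (A.stalk x) :=
  inferInstanceAs (AddCommGroup (Module.DirectLimit (A.nbhdObj x) (A.nbhdMap x)))

open Classical in
instance (x : A.base) : Module Rᵐᵒᵖ (A.stalk x) :=
  inferInstanceAs (Module Rᵐᵒᵖ (Module.DirectLimit (A.nbhdObj x) (A.nbhdMap x)))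

open Classical in
/-- The germ at `x` of a section over a clopen neighbourhood `U` of `x`. -/
def germ {x : A.base} {U : Clopens A.base} (hx : x ∈ U) :
    (A.sh.obj (op U)).carrier →ₗ[Rᵐᵒᵖ] A.stalk x :=
  Module.DirectLimit.of Rᵐᵒᵖ (A.Nbhd x) (A.nbhdObj x) (A.nbhdMap x) (OrderDual.toDual ⟨U, hx⟩)

theorem germ_res {x : A.base} {U V : Clopens A.base} (h : V ≤ U) (hx : x ∈ V)
    (s : (A.sh.obj (op U)).carrier) : A.germ hx ((A.res h).lin s) = A.germ (h hx) s := by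
  classical
  exact Module.DirectLimit.of_f (f := A.nbhdMap x) (i := OrderDual.toDual ⟨U, h hx⟩)
    (j := OrderDual.toDual ⟨V, hx⟩) (hij := h)

theorem exists_germ {x : A.base} (a : A.stalk x) :
    ∃ (U : Clopens A.base) (hx : x ∈ U) (s : (A.sh.obj (op U)).carrier), A.germ hx s = a := by
  classical
  obtain ⟨i, s, hs⟩ := Module.DirectLimit.exists_of (f := A.nbhdMap x) a
  exact ⟨(OrderDual.ofDual i).1, (OrderDual.ofDual i).2, s, hs⟩

theorem exists_res_eq {x : A.base} {U : Clopens A.base} (hx : x ∈ U)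
    {s t : (A.sh.obj (op U)).carrier} (h : A.germ hx s = A.germ hx t) :
    ∃ (V : Clopens A.base) (_ : x ∈ V) (hV : V ≤ U), (A.res hV).lin s = (A.res hV).lin t := by
  classical
  obtain ⟨j, hj, e⟩ := Module.DirectLimit.exists_eq_of_of_eq (f := A.nbhdMap x) h
  exact ⟨(OrderDual.ofDual j).1, (OrderDual.ofDual j).2, hj, e⟩

/-- The set of germs of a section `s` over `U`. -/
def germSet {U : Clopens A.base} (s : (A.sh.obj (op U)).carrier) : Set (Tot A.stalk) :=
  {a | ∃ h : a.base ∈ U, a.val = A.germ h s}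

/-- The topology on the disjoint union of the stalks generated by the sets of germs of sections. -/
instance : TopologicalSpace (Tot A.stalk) :=
  TopologicalSpace.generateFrom
    {O | ∃ (U : Clopens A.base) (s : (A.sh.obj (op U)).carrier), O = A.germSet s}

theorem isOpen_germSet {U : Clopens A.base} (s : (A.sh.obj (op U)).carrier) :
    IsOpen (A.germSet s) := TopologicalSpace.isOpen_generateFrom_of_mem ⟨U, s, rfl⟩

theorem continuous_proj : Continuous (Tot.base : Tot A.stalk → A.base) := by
  rw [isTopologicalBasis_isClopen.continuous_iff]
  intro V hV
  rw [isOpen_iff_forall_mem_open]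
  rintro ⟨x, a⟩ hx
  obtain ⟨U, hU, s, rfl⟩ := A.exists_germ a
  let W : Clopens A.base := U ⊓ ⟨V, hV⟩
  refine ⟨A.germSet ((A.res (inf_le_left : W ≤ U)).lin s), ?_, A.isOpen_germSet _, ?_⟩
  · rintro b ⟨hb, -⟩
    exact hb.2
  · have hxW : x ∈ W := ⟨hU, hx⟩
    exact ⟨hxW, (A.germ_res (inf_le_left : W ≤ U) hxW s).symm⟩

/-- The section of the disjoint union of the stalks defined by `s`, extended by zero. -/
def germSection {U : Clopens A.base} (s : (A.sh.obj (op U)).carrier) (x : A.base) :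
    Tot A.stalk :=
  open Classical in ⟨x, if h : x ∈ U then A.germ h s else 0⟩

theorem germSection_of_mem {U : Clopens A.base} (s : (A.sh.obj (op U)).carrier) {x : A.base}
    (h : x ∈ U) : A.germSection s x = ⟨x, A.germ h s⟩ := by
  simp [germSection, h]

theorem continuousOn_germSection {U : Clopens A.base} (s : (A.sh.obj (op U)).carrier) :
    ContinuousOn (A.germSection s) U := by
  intro x hx
  refine ContinuousAt.continuousWithinAt ?_
  rw [ContinuousAt, TopologicalSpace.tendsto_nhds_generateFrom_iff]
  rintro _ ⟨V, t, rfl⟩ hxt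
  rw [A.germSection_of_mem s hx] at hxt
  obtain ⟨hxV, e⟩ := hxt
  have hm : x ∈ U ⊓ V := ⟨hx, hxV⟩
  have e0 : A.germ hx s = A.germ (show x ∈ V from hxV) t := e
  have hl : U ⊓ V ≤ U := inf_le_left
  have hr : U ⊓ V ≤ V := inf_le_right
  have e' : A.germ hm ((A.res hl).lin s) = A.germ hm ((A.res hr).lin t) :=
    (A.germ_res hl hm s).trans (e0.trans (A.germ_res hr hm t).symm)
  obtain ⟨W, hxW, hW, e2⟩ := A.exists_res_eq _ e'
  refine Filter.mem_of_superset (W.isClopen.isOpen.mem_nhds hxW) fun y hy => ?_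
  have hy' := hW hy
  change A.germSection s y ∈ A.germSet t
  rw [A.germSection_of_mem s hy'.1]
  refine ⟨hy'.2, ?_⟩
  have e3 := congrArg (A.germ hy) e2
  rw [A.germ_res, A.germ_res, A.germ_res, A.germ_res] at e3
  exact e3

theorem continuous_of_germ {Z : Type u} [TopologicalSpace Z] {F : Z → Tot A.stalk}
    (hb : Continuous fun z => (F z).base)
    (h : ∀ z, ∃ (U : Clopens A.base) (s : (A.sh.obj (op U)).carrier), ∀ᶠ z' in 𝓝 z,
      F z' ∈ A.germSet s) : Continuous F := by
  rw [continuous_iff_continuousAt]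
  intro z
  obtain ⟨U, s, hs⟩ := h z
  have hz : (F z).base ∈ U := hs.self_of_nhds.1
  have h1 : ContinuousAt (fun z' => A.germSection s (F z').base) z :=
    ContinuousAt.comp (f := fun z' => (F z').base)
      ((A.continuousOn_germSection s).continuousAt (U.isClopen.isOpen.mem_nhds hz))
      hb.continuousAt
  refine h1.congr ?_
  filter_upwards [hs] with z' hz'
  obtain ⟨h1, h2⟩ := hz'
  rw [A.germSection_of_mem s h1, ← h2]

theorem isLocalHomeomorph_proj : IsLocalHomeomorph (Tot.base : Tot A.stalk → A.base) := by
  refine IsLocalHomeomorph.mk _ fun ⟨x, a⟩ => ?_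
  obtain ⟨U, hU, s, rfl⟩ := A.exists_germ a
  refine ⟨
    { toFun := Tot.base
      invFun := A.germSection s
      source := A.germSet s
      target := U
      map_source' := fun b hb => hb.1
      map_target' := fun y hy => by
        rw [A.germSection_of_mem s hy]
        exact ⟨hy, rfl⟩
      left_inv' := fun b hb => by
        obtain ⟨h1, h2⟩ := hb
        rw [A.germSection_of_mem s h1, ← h2]
      right_inv' := fun y hy => rfl
      open_source := A.isOpen_germSet s
      open_target := U.isClopen.isOpen
      continuousOn_toFun := A.continuous_proj.continuousOn
      continuousOn_invFun := A.continuousOn_germSection s }, ⟨hU, rfl⟩, fun _ _ => rfl⟩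

/-- The étale space of a presheaf: the disjoint union of its stalks. -/
def etaleSpace : EtaleSpace R where
  base := A.base
  fib := A.stalk
  isLocalHomeomorph_proj := A.isLocalHomeomorph_proj
  continuous_zero := by
    refine A.continuous_of_germ continuous_id fun x => ⟨⊤, 0, ?_⟩
    exact Filter.Eventually.of_forall fun y => ⟨trivial, (map_zero _).symm⟩
  continuous_add := by
    let _ := pairTop A.stalk
    have hp := continuous_pairTop A.stalk
    have hb : Continuous fun q : Tot fun x => A.stalk x × A.stalk x => q.base :=
      (A.continuous_proj.comp continuous_fst).comp hp
    refine A.continuous_of_germ hb ?_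
    rintro ⟨x, a, b⟩
    obtain ⟨U, hU, s, rfl⟩ := A.exists_germ a
    obtain ⟨V, hV, t, rfl⟩ := A.exists_germ b
    refine ⟨U ⊓ V, (A.res inf_le_left).lin s + (A.res inf_le_right).lin t, ?_⟩
    have h := (((A.isOpen_germSet s).prod (A.isOpen_germSet t)).preimage hp).mem_nhds
      (x := ⟨x, A.germ hU s, A.germ hV t⟩) ⟨⟨hU, rfl⟩, ⟨hV, rfl⟩⟩
    filter_upwards [h] with q hq
    obtain ⟨⟨h1, e1⟩, ⟨h2, e2⟩⟩ := hq
    refine ⟨⟨h1, h2⟩, ?_⟩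
    dsimp only at e1 e2 ⊢
    have hm : q.base ∈ U ⊓ V := ⟨h1, h2⟩
    have f1 := A.germ_res inf_le_left hm s
    have f2 := A.germ_res inf_le_right hm t
    rw [e1, e2]
    exact ((congrArg₂ (· + ·) f1 f2).symm.trans (map_add (A.germ hm) _ _).symm)
  continuous_smul := by
    have hb : Continuous fun q : Tot A.stalk × R => q.1.base := A.continuous_proj.comp continuous_fst
    refine A.continuous_of_germ hb ?_
    rintro ⟨⟨x, a⟩, r⟩
    obtain ⟨U, hU, s, rfl⟩ := A.exists_germ a
    refine ⟨U, MulOpposite.op r • s, ?_⟩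
    have hc : Continuous fun r' : R => MulOpposite.op r' • s := by fun_prop
    have h1 : {r' : R | MulOpposite.op r' • s = MulOpposite.op r • s} ∈ 𝓝 r :=
      ((isOpen_discrete {MulOpposite.op r • s}).preimage hc).mem_nhds rfl
    filter_upwards [prod_mem_nhds ((A.isOpen_germSet s).mem_nhds ⟨hU, rfl⟩) h1] with q hq
    obtain ⟨⟨h1, e1⟩, e2⟩ := hq
    refine ⟨h1, ?_⟩
    dsimp only at e1 ⊢
    rw [e1, ← map_smul]
    exact congrArg _ e2

open Classical in
/-- The map of stalks `A_{f y} → B_y` induced by a morphism of presheaves: the germ of `s ∈ A(U)` is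
sent to the germ of `Φ_{U,Y}(s)`. -/
def stalkMap {A B : DPresheaf R} (Φ : A ⟶ B) (y : B.base) :
    A.stalk (Φ.f y) →ₗ[Rᵐᵒᵖ] B.stalk y :=
  Module.DirectLimit.lift Rᵐᵒᵖ (A.Nbhd (Φ.f y)) (A.nbhdObj (Φ.f y)) (A.nbhdMap (Φ.f y))
    (fun U => (B.germ (U := clopenPreimage Φ.f (OrderDual.ofDual U).1 ⊓ ⊤)
      ⟨(OrderDual.ofDual U).2, trivial⟩).comp (Φ.app (OrderDual.ofDual U).1 ⊤).lin)
    (fun U V h s => by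
      have e := congrArg (fun g => g.lin s) (Φ.naturality
        (show (OrderDual.ofDual V).1 ≤ (OrderDual.ofDual U).1 from h) (le_refl ⊤))
      change B.germ _ ((A.res _ ≫ Φ.app _ ⊤).lin s) = _
      refine (congrArg _ e).trans ?_
      exact B.germ_res _ _ _)

theorem stalkMap_germ {A B : DPresheaf R} (Φ : A ⟶ B) {y : B.base} {U : Clopens A.base}
    (hU : Φ.f y ∈ U) (s : (A.sh.obj (op U)).carrier) :
    stalkMap Φ y (A.germ hU s) =
      B.germ (U := clopenPreimage Φ.f U ⊓ ⊤) ⟨hU, trivial⟩ ((Φ.app U ⊤).lin s) := by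
  classical
  exact Module.DirectLimit.lift_of _ _ _

theorem continuous_stalkMap {A B : DPresheaf R} (Φ : A ⟶ B) :
    Continuous[pullbackTop A.stalk Φ.f, _]
      fun q => (⟨q.base, stalkMap Φ q.base q.val⟩ : Tot B.stalk) := by
  let _ := pullbackTop A.stalk Φ.f
  have hp : Continuous fun q : Tot fun y => A.stalk (Φ.f y) =>
    (⟨Φ.f q.base, q.val⟩ : Tot A.stalk) := continuous_pullbackTop_fst A.stalk Φ.f
  have hb : Continuous fun q : Tot fun y => A.stalk (Φ.f y) => q.base :=
    continuous_pullbackTop_snd A.stalk Φ.f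
  refine B.continuous_of_germ hb ?_
  rintro ⟨y, a⟩
  obtain ⟨U, hU, s, rfl⟩ := A.exists_germ a
  refine ⟨_, (Φ.app U ⊤).lin s, ?_⟩
  have h := ((A.isOpen_germSet s).preimage hp).mem_nhds (x := ⟨y, A.germ hU s⟩) ⟨hU, rfl⟩
  filter_upwards [h] with q hq
  obtain ⟨h1, e1⟩ := hq
  refine ⟨⟨h1, trivial⟩, ?_⟩
  dsimp only at e1 ⊢
  rw [e1, stalkMap_germ]

end DPresheaf

/-- The functor sending a presheaf to its étale space. -/
def Etale : DPresheaf R ⥤ EtaleSpace R where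
  obj A := A.etaleSpace
  map {A B} Φ :=
    { f := Φ.f
      φ := DPresheaf.stalkMap Φ
      continuous_φ := DPresheaf.continuous_stalkMap Φ }
  map_id A := by
    refine EtaleSpace.Hom.ext rfl (heq_of_eq ?_)
    funext x
    refine LinearMap.ext fun a => ?_
    obtain ⟨U, hU, s, rfl⟩ := A.exists_germ a
    refine (DPresheaf.stalkMap_germ (𝟙 A) hU s).trans ?_
    exact A.germ_res _ _ s
  map_comp {A B C} Φ Ψ := by
    refine EtaleSpace.Hom.ext rfl (heq_of_eq ?_)
    funext z
    refine LinearMap.ext fun a => ?_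
    obtain ⟨U, hU, s, rfl⟩ := A.exists_germ a
    refine (DPresheaf.stalkMap_germ (Φ ≫ Ψ) hU s).trans ?_
    refine Eq.trans ?_ (congrArg (DPresheaf.stalkMap Ψ z)
      (DPresheaf.stalkMap_germ Φ (y := Ψ.f z) hU s)).symm
    refine Eq.trans ?_ (DPresheaf.stalkMap_germ Ψ (U := clopenPreimage Φ.f U ⊓ ⊤)
      ⟨hU, trivial⟩ ((Φ.app U ⊤).lin s)).symm
    exact C.germ_res (clopenPreimage_comp_inf_le Φ.f Ψ.f U ⊤) ⟨hU, trivial⟩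
      ((Ψ.app (clopenPreimage Φ.f U ⊓ ⊤) ⊤).lin ((Φ.app U ⊤).lin s))

end EtaleFunctor

/-! ### The `sheaf' of profinite modules of a precosheaf -/

section CoEtaleFunctor

variable {R : Type u} [Ring R] [TopologicalSpace R]

namespace PPrecosheaf

variable (M : PPrecosheaf R)

/-- The stalk `lim_{U ∋ x} M(U)` of a precosheaf, as a submodule of the product of the `M(U)`. -/
def stalkSubmodule (x : M.base) :
    Submodule R (∀ U : {U : Clopens M.base // x ∈ U}, (M.cosh.obj U.1).carrier) where
  carrier := {m | ∀ (U V : {U : Clopens M.base // x ∈ U}) (h : U.1 ≤ V.1),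
    (M.cor h).lin (m U) = m V}
  add_mem' {m n} hm hn U V h := (map_add (M.cor h).lin _ _).trans
    (congrArg₂ (· + ·) (hm U V h) (hn U V h))
  zero_mem' U V h := map_zero (M.cor h).lin
  smul_mem' r m hm U V h := (map_smul (M.cor h).lin r _).trans (congrArg (r • ·) (hm U V h))

/-- The stalk `lim_{U ∋ x} M(U)` of a precosheaf. -/
def stalk (x : M.base) : Type u := M.stalkSubmodule x

instance (x : M.base) : AddCommGroup (M.stalk x) :=
  inferInstanceAs (AddCommGroup (M.stalkSubmodule x))

instance (x : M.base) : Module R (M.stalk x) :=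
  inferInstanceAs (Module R (M.stalkSubmodule x))

/-- The projection `M_x → M(U)` for a clopen neighbourhood `U` of `x`. -/
def corAt {x : M.base} {U : Clopens M.base} (hx : x ∈ U) :
    M.stalk x →ₗ[R] (M.cosh.obj U).carrier where
  toFun m := m.1 ⟨U, hx⟩
  map_add' _ _ := rfl
  map_smul' _ _ := rfl

theorem corAt_cor {x : M.base} {U V : Clopens M.base} (h : U ≤ V) (hx : x ∈ U) (m : M.stalk x) :
    (M.cor h).lin (M.corAt hx m) = M.corAt (h hx) m := m.2 ⟨U, hx⟩ ⟨V, h hx⟩ h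

theorem stalk_ext {x : M.base} {m n : M.stalk x}
    (h : ∀ (U : Clopens M.base) (hx : x ∈ U), M.corAt hx m = M.corAt hx n) : m = n :=
  Subtype.ext (funext fun U => h U.1 U.2)

/-- The disjoint union of the stalks of a precosheaf. -/
abbrev TotStalk : Type u := Tot M.stalk

/-- The points of the disjoint union of the stalks which lie over `U` and whose image in `M(U)` lies
in `W`. -/
def subbasic (U : Clopens M.base) (W : Set (M.cosh.obj U).carrier) : Set M.TotStalk :=
  {m | ∃ h : m.base ∈ U, M.corAt h m.val ∈ W}

/-- The topology on the disjoint union of the stalks of a precosheaf generated by the sets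
`subbasic U W` with `W` open. -/
instance : TopologicalSpace M.TotStalk :=
  TopologicalSpace.generateFrom
    {O | ∃ (U : Clopens M.base) (W : Set (M.cosh.obj U).carrier), IsOpen W ∧ O = M.subbasic U W}

theorem isOpen_subbasic (U : Clopens M.base) {W : Set (M.cosh.obj U).carrier} (hW : IsOpen W) :
    IsOpen (M.subbasic U W) := TopologicalSpace.isOpen_generateFrom_of_mem ⟨U, W, hW, rfl⟩

theorem continuous_proj : Continuous (Tot.base : M.TotStalk → M.base) := by
  rw [isTopologicalBasis_isClopen.continuous_iff]
  intro V hV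
  convert M.isOpen_subbasic ⟨V, hV⟩ isOpen_univ using 1
  ext m
  exact ⟨fun h => ⟨h, trivial⟩, fun h => h.1⟩

/-- The projection to `M(U)`, extended by zero to the points not lying over `U`. -/
def extCor (U : Clopens M.base) (m : M.TotStalk) : (M.cosh.obj U).carrier :=
  open Classical in if h : m.base ∈ U then M.corAt h m.val else 0

theorem extCor_of_mem {U : Clopens M.base} {m : M.TotStalk} (h : m.base ∈ U) :
    M.extCor U m = M.corAt h m.val := by simp [extCor, h]

theorem extCor_of_notMem {U : Clopens M.base} {m : M.TotStalk} (h : m.base ∉ U) :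
    M.extCor U m = 0 := by simp [extCor, h]

theorem continuous_extCor (U : Clopens M.base) : Continuous (M.extCor U) := by
  rw [continuous_def]
  intro W hW
  by_cases h0 : (0 : (M.cosh.obj U).carrier) ∈ W
  · convert (M.isOpen_subbasic U hW).union
      (U.isClopen.compl.isOpen.preimage M.continuous_proj) using 1
    ext m
    by_cases hm : m.base ∈ U
    · simp [extCor_of_mem, subbasic, hm]
    · simp [extCor_of_notMem, subbasic, hm, h0]
  · convert M.isOpen_subbasic U hW using 1
    ext m
    by_cases hm : m.base ∈ U
    · simp [extCor_of_mem, subbasic, hm]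
    · simp [extCor_of_notMem, subbasic, hm, h0]

/-- The embedding of the disjoint union of the stalks in `X × ∏_U M(U)`. -/
def embed (m : M.TotStalk) : M.base × (∀ U : Clopens M.base, (M.cosh.obj U).carrier) :=
  (m.base, fun U => M.extCor U m)

theorem isInducing_embed : Topology.IsInducing M.embed := by
  constructor
  apply le_antisymm
  · rw [← continuous_iff_le_induced]
    exact M.continuous_proj.prodMk (continuous_pi M.continuous_extCor)
  · refine le_generateFrom ?_
    rintro _ ⟨U, W, hW, rfl⟩
    refine ⟨(U : Set M.base) ×ˢ ((fun n => n U) ⁻¹' W),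
      U.isClopen.isOpen.prod (hW.preimage (continuous_apply U)), ?_⟩
    ext m
    constructor
    · rintro ⟨h1, h2⟩
      exact ⟨h1, (M.extCor_of_mem h1) ▸ h2⟩
    · rintro ⟨h1, h2⟩
      refine ⟨h1, ?_⟩
      change M.extCor U m ∈ W
      rwa [M.extCor_of_mem h1]

theorem injective_embed : Function.Injective M.embed := by
  rintro ⟨x, m⟩ ⟨y, n⟩ h
  obtain rfl : x = y := congrArg Prod.fst h
  have : m = n := by
    refine M.stalk_ext fun U hx => ?_
    have h1 := congrFun (congrArg Prod.snd h) U
    change M.extCor U ⟨x, m⟩ = M.extCor U ⟨x, n⟩ at h1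
    rwa [M.extCor_of_mem hx, M.extCor_of_mem hx] at h1
  rw [this]

theorem isClosed_range_embed : IsClosed (Set.range M.embed) := by
  have h : Set.range M.embed =
      (⋂ U : Clopens M.base, {q | q.1 ∈ U} ∪ {q | q.2 U = 0}) ∩
      ⋂ (U : Clopens M.base) (V : Clopens M.base) (k : U ≤ V),
        {q | q.1 ∈ U}ᶜ ∪ {q | (M.cor k).lin (q.2 U) = q.2 V} := by
    ext ⟨x, n⟩
    constructor
    · rintro ⟨m, hm⟩
      obtain rfl : m.base = x := congrArg Prod.fst hm
      obtain rfl : (fun U => M.extCor U m) = n := congrArg Prod.snd hm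
      refine ⟨Set.mem_iInter.2 fun U => ?_, Set.mem_iInter₂.2 fun U V => Set.mem_iInter.2
        fun k => ?_⟩
      · by_cases hU : m.base ∈ U
        · exact Or.inl hU
        · exact Or.inr (M.extCor_of_notMem hU)
      · by_cases hU : m.base ∈ U
        · refine Or.inr ?_
          change (M.cor k).lin (M.extCor U m) = M.extCor V m
          rw [M.extCor_of_mem hU, M.extCor_of_mem (k hU)]
          exact M.corAt_cor k hU m.val
        · exact Or.inl hU
    · rintro ⟨h1, h2⟩
      have h1' : ∀ U : Clopens M.base, x ∈ U ∨ n U = 0 := fun U => Set.mem_iInter.1 h1 U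
      have h2' : ∀ (U V : Clopens M.base) (k : U ≤ V), x ∉ U ∨ (M.cor k).lin (n U) = n V :=
        fun U V k => Set.mem_iInter.1 (Set.mem_iInter₂.1 h2 U V) k
      refine ⟨⟨x, ⟨fun U => n U.1, fun U V k => (h2' U.1 V.1 k).resolve_left
        fun hn => hn U.2⟩⟩, ?_⟩
      refine Prod.ext rfl (funext fun U => ?_)
      change M.extCor U _ = n U
      by_cases hU : x ∈ U
      · rw [M.extCor_of_mem hU]
        rfl
      · rw [M.extCor_of_notMem hU, (h1' U).resolve_left hU]
  rw [h]
  refine (isClosed_iInter fun U => ?_).inter (isClosed_iInter fun U => isClosed_iInter fun V =>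
    isClosed_iInter fun k => ?_)
  · refine (U.isClopen.isClosed.preimage continuous_fst).union (isClosed_eq ?_ continuous_const)
    exact (continuous_apply U).comp continuous_snd
  · refine (U.isClopen.preimage continuous_fst).compl.isClosed.union (isClosed_eq ?_ ?_)
    · exact (M.cor k).lin.continuous.comp ((continuous_apply U).comp continuous_snd)
    · exact (continuous_apply V).comp continuous_snd

theorem profinite_totStalk :
    CompactSpace M.TotStalk ∧ T2Space M.TotStalk ∧ TotallyDisconnectedSpace M.TotStalk :=
  profinite_of_closed_range M.isInducing_embed M.injective_embed M.isClosed_range_embed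

theorem continuous_totStalk {Z : Type u} [TopologicalSpace Z] {F : Z → M.TotStalk}
    (hb : Continuous fun z => (F z).base) (h : ∀ U, Continuous fun z => M.extCor U (F z)) :
    Continuous F :=
  M.isInducing_embed.continuous_iff.2 (hb.prodMk (continuous_pi h))

theorem extCor_add (U : Clopens M.base) {x : M.base} (m n : M.stalk x) :
    M.extCor U ⟨x, m + n⟩ = M.extCor U ⟨x, m⟩ + M.extCor U ⟨x, n⟩ := by
  by_cases hx : x ∈ U
  · rw [M.extCor_of_mem hx, M.extCor_of_mem hx, M.extCor_of_mem hx]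
    exact map_add (M.corAt hx) m n
  · rw [M.extCor_of_notMem hx, M.extCor_of_notMem hx, M.extCor_of_notMem hx, add_zero]

theorem extCor_smul (U : Clopens M.base) {x : M.base} (r : R) (m : M.stalk x) :
    M.extCor U ⟨x, r • m⟩ = r • M.extCor U ⟨x, m⟩ := by
  by_cases hx : x ∈ U
  · rw [M.extCor_of_mem hx, M.extCor_of_mem hx]
    exact map_smul (M.corAt hx) r m
  · rw [M.extCor_of_notMem hx, M.extCor_of_notMem hx, smul_zero]

theorem continuous_stalk_add :
    Continuous[pairTop M.stalk, _] fun q => (⟨q.base, q.val.1 + q.val.2⟩ : M.TotStalk) := by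
  let _ := pairTop M.stalk
  have hp := continuous_pairTop M.stalk
  have hb : Continuous fun q : Tot fun x => M.stalk x × M.stalk x => q.base :=
    (M.continuous_proj.comp continuous_fst).comp hp
  refine M.continuous_totStalk (F := fun q : Tot fun x => M.stalk x × M.stalk x =>
    ⟨q.base, q.val.1 + q.val.2⟩) hb fun U => ?_
  have hc : Continuous fun q : Tot fun x => M.stalk x × M.stalk x =>
      M.extCor U ⟨q.base, q.val.1⟩ + M.extCor U ⟨q.base, q.val.2⟩ :=
    ((M.continuous_extCor U).comp (continuous_fst.comp hp)).add
      ((M.continuous_extCor U).comp (continuous_snd.comp hp))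
  exact hc.congr fun q => (M.extCor_add U _ _).symm

theorem continuous_stalk_smul :
    Continuous fun q : R × M.TotStalk => (⟨q.2.base, q.1 • q.2.val⟩ : M.TotStalk) := by
  have hb : Continuous fun q : R × M.TotStalk => q.2.base :=
    M.continuous_proj.comp continuous_snd
  refine M.continuous_totStalk (F := fun q : R × M.TotStalk => ⟨q.2.base, q.1 • q.2.val⟩)
    hb fun U => ?_
  have hc : Continuous fun q : R × M.TotStalk => q.1 • M.extCor U q.2 :=
    continuous_fst.smul ((M.continuous_extCor U).comp continuous_snd)
  exact hc.congr fun q => (M.extCor_smul U _ _).symm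

/-- The `sheaf' of profinite modules of a precosheaf: the disjoint union of its stalks. -/
def proSheaf : ProSheaf R where
  base := M.base
  fib := M.stalk
  compact := M.profinite_totStalk.1
  t2 := M.profinite_totStalk.2.1
  totDisc := M.profinite_totStalk.2.2
  continuous_proj := M.continuous_proj
  continuous_add := M.continuous_stalk_add
  continuous_smul := M.continuous_stalk_smul

/-- The map of stalks `N_y → M_{f y}` induced by a morphism of precosheaves, with components
`N_y → N(f⁻¹(U)) → M(U)`, where the second map is `Ψ_{U,Y}`. -/
def stalkMap {N M : PPrecosheaf R} (Ψ : N ⟶ M) (y : N.base) :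
    N.stalk y →ₗ[R] M.stalk (Ψ.f y) where
  toFun n := ⟨fun U => (Ψ.app U.1 ⊤).lin (N.corAt (U := clopenPreimage Ψ.f U.1 ⊓ ⊤)
      ⟨U.2, trivial⟩ n), fun U V h => by
    have e := congrArg (fun g => g.lin (N.corAt (U := clopenPreimage Ψ.f U.1 ⊓ ⊤)
      ⟨U.2, trivial⟩ n)) (Ψ.naturality h (le_refl ⊤))
    refine e.symm.trans ?_
    exact congrArg (Ψ.app V.1 ⊤).lin
      (N.corAt_cor (U := clopenPreimage Ψ.f U.1 ⊓ ⊤) (V := clopenPreimage Ψ.f V.1 ⊓ ⊤)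
        (clopenPreimage_inf_mono Ψ.f h le_rfl) ⟨U.2, trivial⟩ n)⟩
  map_add' m n := Subtype.ext (funext fun U => by
    simp only [map_add]
    rfl)
  map_smul' r n := Subtype.ext (funext fun U => by
    simp only [map_smul]
    rfl)

theorem corAt_stalkMap {N M : PPrecosheaf R} (Ψ : N ⟶ M) {y : N.base} {U : Clopens M.base}
    (hU : Ψ.f y ∈ U) (n : N.stalk y) : M.corAt hU (stalkMap Ψ y n) =
      (Ψ.app U ⊤).lin (N.corAt (U := clopenPreimage Ψ.f U ⊓ ⊤) ⟨hU, trivial⟩ n) := rfl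

theorem continuous_stalkMap {N M : PPrecosheaf R} (Ψ : N ⟶ M) :
    Continuous fun n : N.TotStalk => (⟨Ψ.f n.base, stalkMap Ψ n.base n.val⟩ : M.TotStalk) := by
  refine M.continuous_totStalk (F := fun n : N.TotStalk =>
    ⟨Ψ.f n.base, stalkMap Ψ n.base n.val⟩) (Ψ.f.continuous.comp N.continuous_proj) fun U => ?_
  have hc : Continuous fun n : N.TotStalk =>
      (Ψ.app U ⊤).lin (N.extCor (clopenPreimage Ψ.f U ⊓ ⊤) n) :=
    (Ψ.app U ⊤).lin.continuous.comp (N.continuous_extCor _)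
  refine hc.congr fun n => ?_
  by_cases hn : Ψ.f n.base ∈ U
  · have hm : n.base ∈ clopenPreimage Ψ.f U ⊓ ⊤ := ⟨hn, trivial⟩
    rw [M.extCor_of_mem hn, N.extCor_of_mem hm]
    exact (corAt_stalkMap Ψ hn n.val).symm
  · have hm : n.base ∉ clopenPreimage Ψ.f U ⊓ ⊤ := fun h => hn h.1
    rw [M.extCor_of_notMem hn, N.extCor_of_notMem hm, map_zero]

end PPrecosheaf

/-- The functor sending a precosheaf to its `sheaf' of profinite modules. -/
def CoEtale : PPrecosheaf R ⥤ ProSheaf R where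
  obj M := M.proSheaf
  map {N M} Ψ :=
    { f := Ψ.f
      ψ := PPrecosheaf.stalkMap Ψ
      continuous_ψ := PPrecosheaf.continuous_stalkMap Ψ }
  map_id M := by
    refine ProSheaf.Hom.ext rfl (heq_of_eq ?_)
    funext x
    refine LinearMap.ext fun m => M.stalk_ext fun U hx => ?_
    exact M.corAt_cor (clopenPreimage_id_inf_le U ⊤) ⟨hx, trivial⟩ m
  map_comp {L N M} Φ Ψ := by
    refine ProSheaf.Hom.ext rfl (heq_of_eq ?_)
    funext y
    refine LinearMap.ext fun m => M.stalk_ext fun U hx => ?_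
    exact congrArg (fun a => (Ψ.app U ⊤).lin
      ((Φ.app (clopenPreimage Ψ.f U ⊓ ⊤) ⊤).lin a))
      (L.corAt_cor (clopenPreimage_comp_inf_le Ψ.f Φ.f U ⊤) ⟨hx, trivial⟩ m)

/-! ### The dual functors -/

/-- The dual `sheaf' `CoÉtale(Shf(A)^∨)` of an étale space of discrete modules. -/
def dualSheaf [CompactSpace R] : (EtaleSpace R)ᵒᵖ ⥤ ProSheaf R :=
  Shf.op ⋙ dualPresheaf ⋙ CoEtale

/-- The dual étale space `Étale(CoShf(M)^∨)` of a `sheaf' of profinite modules, for a choice of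
profinite direct sums. -/
def dualEtale (S : ∀ M : ProSheaf R, M.ProfiniteSum) : (ProSheaf R)ᵒᵖ ⥤ EtaleSpace R :=
  (CoShf S).op ⋙ dualPrecosheaf ⋙ Etale

/-- The morphism of fibres `A_{f y} → B_y` of a morphism `(φ, f)` of étale spaces. -/
def EtaleSpace.fibreMap {A B : EtaleSpace R} (g : A ⟶ B) (y : B.base) :
    A.fibre (g.f y) ⟶ B.fibre y := ⟨g.φ y⟩

theorem ProSheaf.continuous_fibre_incl (M : ProSheaf R) (x : M.base) :
    Continuous fun m : (M.fibre x).carrier => (⟨x, m⟩ : Tot M.fib) := continuous_induced_dom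

/-- The morphism of fibres `N_y → M_{f y}` of a morphism `(ψ, f)` of `sheaves' of profinite
modules. -/
def ProSheaf.fibreMap {N M : ProSheaf R} (g : N ⟶ M) (y : N.base) :
    N.fibre y ⟶ M.fibre (g.f y) :=
  ⟨{ toLinearMap := g.ψ y
     cont := continuous_induced_rng.2 (g.continuous_ψ.comp (N.continuous_fibre_incl y)) }⟩

end CoEtaleFunctor

end

/-!
Everything is reduced to Pontryagin duality for discrete torsion groups and profinite groups,
applied fibre by fibre, together with the fact that `ℝ / ℤ` has no small subgroups, which turns
statements about one fibre into statements about the fibres over a neighbourhood.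

Pontryagin duality. Characters separate points (`exists_continuousAddMonoidHom_apply_ne_zero`). A
continuous character of `A^∨`, with `A` discrete and torsion, is trivial on the characters killing
some finite set `F ⊆ A`, and is then an evaluation by induction on `F`, since the `n`-torsion of the
circle is cyclic (`DMod.Dual.exists_eq_eval`). This gives `A ≅ A^∨∨` and, by a separation argument,
`M ≅ M^∨∨` (`evalIsoD`, `evalIsoP`).

Profinite direct sums. Let `chars M` be the discrete module of the continuous maps `M → ℝ / ℤ` that
are additive on fibres. The dual of `chars M` is a profinite direct sum of `M`
(`ProSheaf.charsSum`), and for every profinite direct sum the characters of `⊞ M` are those of `M`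
(`ProSheaf.ProfiniteSum.charMap_bijective`). The dual étale space of `M` is therefore made of germs
of characters of `M`.

Fibres. Restriction of germs to the fibre identifies the fibre of the dual of `M` with `M_x^∨`
(`dualEtale.fibreIso`): a character that vanishes on a fibre vanishes on the neighbouring ones, and
a character of one fibre, having finite image, extends to the neighbouring ones
(`ProSheaf.exists_char_extension`). The fibre of the dual of `A` is `A_x^∨`
(`dualSheaf.fibreIso`) because every point of `A_x` is the value of a local section, and two such
sections agree near `x`.

Double duals. On fibres the map from a space to its double dual is the composite of the evaluation
with these two identifications. It is continuous (`EtaleSpace.continuous_bidual`,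
`ProSheaf.continuous_bidual`), and its inverse is continuous because a bijective local
homeomorphism, respectively a continuous bijection of compact Hausdorff spaces, is a homeomorphism.
This is the equivalence `dualEquivalence`. Finally, global sections of the dual of `M` are
characters of `M`, which gives `dualEtale.continuousProductIso`; the other isomorphism,
`dualSheaf.directSumIso`, follows from it by duality.
-/

noncomputable section

/-! ### Characters with values in the circle -/

namespace UnitAddCircle

/-- The circle has no small subgroups. -/
theorem exists_nhds_no_small_subgroups : ∃ V : Set UnitAddCircle, IsOpen V ∧ 0 ∈ V ∧
    ∀ t : UnitAddCircle, (∀ n : ℕ, n • t ∈ V) → t = 0 := by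
  refine ⟨AddCircle.toCircle ⁻¹' Circle.centeredArc (Real.pi / 2),
    (Circle.isOpen_centeredArc _).preimage AddCircle.continuous_toCircle, ?_, fun t ht => ?_⟩
  · rw [Set.mem_preimage, AddCircle.toCircle_zero,
      Circle.mem_centeredArc (by linarith [Real.pi_pos])]
    simp [Real.pi_pos]
  · apply AddCircle.injective_toCircle (T := 1) one_ne_zero
    rw [AddCircle.toCircle_zero]
    refine Circle.eq_one_of_forall_pow_mem_centeredArc_pi_div_two fun n _ => ?_
    have := ht n
    rwa [Set.mem_preimage, AddCircle.toCircle_nsmul] at this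

/-- Characters with values in `ℝ / ℤ` separate the points of an abelian group. -/
theorem exists_addMonoidHom_apply_ne_zero {A : Type*} [AddCommGroup A] {a : A} (ha : a ≠ 0) :
    ∃ χ : A →+ UnitAddCircle, χ a ≠ 0 := by
  obtain ⟨c, hc⟩ := CharacterModule.exists_character_apply_ne_zero_of_ne_zero ha
  -- `CharacterModule` takes values in `ℚ / ℤ`, which embeds in `ℝ / ℤ`
  let j : AddCircle (1 : ℚ) →+ UnitAddCircle :=
    QuotientAddGroup.map _ _ (Rat.castHom ℝ).toAddMonoidHom (by
      rw [AddSubgroup.zmultiples_le]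
      exact AddSubgroup.mem_zmultiples_iff.2 ⟨1, by simp⟩)
  refine ⟨j.comp c, fun h => hc ?_⟩
  change j (c a) = 0 at h
  induction hq : c a using QuotientAddGroup.induction_on with
  | H q =>
    rw [hq] at h
    have h1 : ((q : ℝ) : UnitAddCircle) = 0 := h
    obtain ⟨n, hn⟩ := (AddCircle.coe_eq_zero_iff (1 : ℝ)).1 h1
    refine (AddCircle.coe_eq_zero_iff (1 : ℚ)).2 ⟨n, ?_⟩
    have : ((n : ℚ) : ℝ) = (q : ℝ) := by simpa using hn
    simpa using (Rat.cast_injective this)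

theorem exists_eq_zsmul_of_nsmul_eq_zero {n : ℕ} (hn : 0 < n) {t : UnitAddCircle}
    (ht : n • t = 0) : ∃ k : ℤ, t = k • (((1 : ℝ) / n : ℝ) : UnitAddCircle) := by
  induction t using QuotientAddGroup.induction_on with
  | H r =>
    have h1 : ((n • r : ℝ) : UnitAddCircle) = 0 := ht
    obtain ⟨k, hk⟩ := (AddCircle.coe_eq_zero_iff (1 : ℝ)).1 h1
    refine ⟨k, ?_⟩
    have hn' : (n : ℝ) ≠ 0 := by positivity
    have : r = k • ((1 : ℝ) / n) := by
      have h2 : (k : ℝ) = n * r := by simpa using hk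
      rw [zsmul_eq_mul, h2]
      field_simp
    rw [← AddCircle.coe_zsmul, ← this]

/-- If `α` and `χ` are homomorphisms from a group to the circle, `n α = 0` and the kernel of `χ`
contains that of `α`, then `χ` is a multiple of `α`, because the `n`-torsion of the circle is
cyclic. -/
theorem exists_eq_zsmul_of_ker_le {G : Type*} [AddCommGroup G] {n : ℕ} (hn : 0 < n)
    (α χ : G →+ UnitAddCircle) (hα : ∀ g, n • α g = 0) (h : α.ker ≤ χ.ker) :
    ∃ k : ℤ, χ = k • α := by
  let τ : UnitAddCircle := (((1 : ℝ) / n : ℝ) : UnitAddCircle)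
  let Z : AddSubgroup ℤ := α.range.comap (zmultiplesHom _ τ)
  obtain ⟨d, hd⟩ := Int.subgroup_cyclic Z
  rw [← AddSubgroup.zmultiples_eq_closure] at hd
  have hτ : ∀ m : ℤ, m • τ = 0 ↔ (n : ℤ) ∣ m := fun m => by
    have h1 : addOrderOf τ = n := AddCircle.addOrderOf_period_div (p := (1 : ℝ)) hn
    rw [← addOrderOf_dvd_iff_zsmul_eq_zero, h1]
  have hnZ : (n : ℤ) ∈ Z := ⟨0, by simpa using ((hτ n).2 dvd_rfl).symm⟩
  have hdZ : d ∈ Z := hd ▸ AddSubgroup.mem_zmultiples d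
  obtain ⟨e, he⟩ := AddSubgroup.mem_zmultiples_iff.1 (hd ▸ hnZ)
  rw [smul_eq_mul] at he
  obtain ⟨g₀, hg₀⟩ := hdZ
  have hg₀ : α g₀ = d • τ := hg₀
  -- `α g₀ = d / n` generates the image of `α`; it has order `e = n / d`, which kills `χ g₀`
  have hχ : e • χ g₀ = 0 := by
    rw [← map_zsmul]
    refine h ?_
    rw [AddMonoidHom.mem_ker, map_zsmul, hg₀, ← mul_smul, he, hτ]
  have hgen : ∃ k : ℤ, χ g₀ = k • α g₀ := by
    have hn0 : n • χ g₀ = 0 := by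
      rw [← natCast_zsmul, ← he, mul_comm, mul_smul, hχ, smul_zero]
    obtain ⟨j, hj⟩ := exists_eq_zsmul_of_nsmul_eq_zero hn hn0
    have he0 : e ≠ 0 := by
      rintro rfl
      simp at he
      omega
    rw [hj, ← mul_smul, hτ, ← he] at hχ
    obtain ⟨c, rfl⟩ := (mul_dvd_mul_iff_left he0).1 hχ
    exact ⟨c, by rw [hj, hg₀, ← mul_smul, mul_comm]⟩
  obtain ⟨k, hk⟩ := hgen
  refine ⟨k, AddMonoidHom.ext fun g => ?_⟩
  obtain ⟨j, hj⟩ := exists_eq_zsmul_of_nsmul_eq_zero hn (hα g)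
  have hjZ : j ∈ Z := ⟨g, hj⟩
  rw [hd] at hjZ
  obtain ⟨i, hi⟩ := AddSubgroup.mem_zmultiples_iff.1 hjZ
  have h1 : α (g - i • g₀) = 0 := by
    rw [map_sub, map_zsmul, hg₀, ← mul_smul, ← smul_eq_mul, hi, sub_eq_zero]
    exact hj
  have h2 : χ (g - i • g₀) = 0 := h h1
  rw [map_sub, sub_eq_zero, map_zsmul] at h1 h2
  rw [AddMonoidHom.zsmul_apply, h1, h2, hk, smul_comm]

end UnitAddCircle

section ProfiniteGroups

variable {G : Type*} [AddCommGroup G] [TopologicalSpace G] [IsTopologicalAddGroup G]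
  [CompactSpace G] [TotallyDisconnectedSpace G]

/-- The characters of a profinite abelian group that vanish on a closed subgroup separate it from
the points outside it. -/
theorem exists_continuousAddMonoidHom_apply_ne_zero (N : AddSubgroup G) (hN : IsClosed (N : Set G))
    {g : G} (hg : g ∉ N) : ∃ χ : G →ₜ+ UnitAddCircle, (∀ n ∈ N, χ n = 0) ∧ χ g ≠ 0 := by
  have hinf := ProfiniteGrp.closedAddSubgroup_eq_sInf_open (⟨N, hN⟩ : ClosedAddSubgroup G)
  have hg' : g ∉ sInf {K : AddSubgroup G | IsOpen (K : Set G) ∧ N ≤ K} := fun h => hg (hinf.ge h)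
  simp only [AddSubgroup.mem_sInf, not_forall] at hg'
  obtain ⟨K, ⟨hK, hNK⟩, hgK⟩ := hg'
  obtain ⟨χ, hχ⟩ := UnitAddCircle.exists_addMonoidHom_apply_ne_zero
    (a := QuotientAddGroup.mk' K g) (by simpa using hgK)
  have hker : ∀ n ∈ K, χ (QuotientAddGroup.mk' K n) = 0 := fun n hn => by
    rw [show QuotientAddGroup.mk' K n = 0 by simpa using hn, map_zero]
  refine ⟨⟨χ.comp (QuotientAddGroup.mk' K), ?_⟩, fun n hn => hker n (hNK hn), hχ⟩
  refine continuous_of_continuousAt_zero (χ.comp (QuotientAddGroup.mk' K))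
    (ContinuousAt.congr (f := fun _ => 0) continuousAt_const ?_)
  filter_upwards [hK.mem_nhds K.zero_mem] with n hn
  exact (hker n hn).symm

/-- Characters of profinite groups have open kernels, since the circle has no small subgroups. -/
theorem eventually_apply_eq_zero (χ : G →ₜ+ UnitAddCircle) : ∀ᶠ g in 𝓝 (0 : G), χ g = 0 := by
  obtain ⟨V, hV, h0, hsmall⟩ := UnitAddCircle.exists_nhds_no_small_subgroups
  obtain ⟨K, hK⟩ := ProfiniteGrp.exist_openNormalAddSubgroup_sub_open_nhds_of_zero
    (hV.preimage (map_continuous χ)) (by simpa using h0)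
  filter_upwards [K.toOpenAddSubgroup.isOpen.mem_nhds K.zero_mem] with g hg
  refine hsmall _ fun n => ?_
  rw [← map_nsmul]
  exact hK (K.nsmul_mem hg n)

/-- A character of a profinite abelian group takes finitely many values. -/
theorem finite_range_of_profinite (χ : G →ₜ+ UnitAddCircle) : (Set.range χ).Finite := by
  refine IsLocallyConstant.range_finite ((IsLocallyConstant.iff_eventually_eq _).2 fun g => ?_)
  have h : Filter.Tendsto (fun h => h - g) (𝓝 g) (𝓝 0) := by
    have : ContinuousAt (fun h : G => h - g) g := by fun_prop
    simpa [ContinuousAt] using this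
  filter_upwards [h.eventually (eventually_apply_eq_zero χ)] with h hh
  rwa [map_sub, sub_eq_zero] at hh

end ProfiniteGroups

section Duality

variable {R : Type u} [Ring R] [TopologicalSpace R]

/-! ### Isomorphisms of discrete and of profinite modules -/

/-- A bijective morphism of discrete modules is an isomorphism. -/
def DMod.isoOfBijective {A B : DMod R} (f : A ⟶ B) (hf : Function.Bijective f.lin) : A ≅ B where
  hom := f
  inv := ⟨(LinearEquiv.ofBijective f.lin hf).symm⟩
  hom_inv_id := DMod.Hom.ext
    (LinearMap.ext fun a => (LinearEquiv.ofBijective f.lin hf).symm_apply_apply a)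
  inv_hom_id := DMod.Hom.ext
    (LinearMap.ext fun a => (LinearEquiv.ofBijective f.lin hf).apply_symm_apply a)

/-- A bijective morphism of profinite modules is an isomorphism, since a continuous bijection of
compact Hausdorff spaces is a homeomorphism. -/
def PMod.isoOfBijective {M N : PMod R} (f : M ⟶ N) (hf : Function.Bijective f.lin) : M ≅ N where
  hom := f
  inv := ⟨{ (LinearEquiv.ofBijective (f.lin : M.carrier →ₗ[R] N.carrier) hf).symm.toLinearMap with
    cont := Continuous.continuous_symm_of_equiv_compact_to_t2
      (f := (LinearEquiv.ofBijective (f.lin : M.carrier →ₗ[R] N.carrier) hf).toEquiv)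
      f.lin.continuous }⟩
  hom_inv_id := PMod.Hom.ext (ContinuousLinearMap.ext fun m =>
    (LinearEquiv.ofBijective (f.lin : M.carrier →ₗ[R] N.carrier) hf).symm_apply_apply m)
  inv_hom_id := PMod.Hom.ext (ContinuousLinearMap.ext fun m =>
    (LinearEquiv.ofBijective (f.lin : M.carrier →ₗ[R] N.carrier) hf).apply_symm_apply m)

/-- The underlying bijection of an isomorphism of discrete modules. -/
def DMod.isoEquiv {A B : DMod R} (e : A ≅ B) : A.carrier ≃ B.carrier where
  toFun := e.hom.lin
  invFun := e.inv.lin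
  left_inv a := congrArg (fun f : A ⟶ A => f.lin a) e.hom_inv_id
  right_inv b := congrArg (fun f : B ⟶ B => f.lin b) e.inv_hom_id

/-- The underlying bijection of an isomorphism of profinite modules. -/
def PMod.isoEquiv {A B : PMod R} (e : A ≅ B) : A.carrier ≃ B.carrier where
  toFun := e.hom.lin
  invFun := e.inv.lin
  left_inv a := congrArg (fun f : A ⟶ A => f.lin a) e.hom_inv_id
  right_inv b := congrArg (fun f : B ⟶ B => f.lin b) e.inv_hom_id

theorem DMod.iso_bijective {A B : DMod R} (e : A ≅ B) : Function.Bijective e.hom.lin :=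
  (DMod.isoEquiv e).bijective

theorem PMod.iso_bijective {A B : PMod R} (e : A ≅ B) : Function.Bijective e.hom.lin :=
  (PMod.isoEquiv e).bijective

/-! ### Pontryagin duality for discrete torsion modules and profinite modules -/

theorem DMod.Dual.exists_apply_ne_zero (A : DMod R) {a : A.carrier} (ha : a ≠ 0) :
    ∃ f : A.Dual, f a ≠ 0 := by
  obtain ⟨χ, hχ⟩ := UnitAddCircle.exists_addMonoidHom_apply_ne_zero ha
  exact ⟨ContinuousAddMonoidHom.mk χ continuous_of_discreteTopology, hχ⟩

/-- A homomorphism `A^∨ → ℝ/ℤ` vanishing on the characters that kill a given finite subset of `A` is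
the evaluation at an element of `A`. The induction removes one element `a` of the finite set: on the
characters killing the others, the homomorphism is a multiple of the evaluation at `a`. -/
theorem DMod.Dual.exists_eq_eval_of_finset [CompactSpace R] (A : DMod R) (F : Finset A.carrier) :
    ∀ χ : A.Dual →+ UnitAddCircle, (∀ f : A.Dual, (∀ a ∈ F, f a = 0) → χ f = 0) →
      ∃ b : A.carrier, ∀ f : A.Dual, χ f = f b := by
  classical
  induction F using Finset.induction_on with
  | empty => exact fun χ h => ⟨0, fun f => by rw [map_zero]; exact h f (by simp)⟩
  | insert a F _ ih =>
    intro χ h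
    let ev : A.Dual →+ UnitAddCircle :=
      { toFun := fun f => f a, map_zero' := rfl, map_add' := fun _ _ => rfl }
    let K : AddSubgroup A.Dual :=
      { carrier := {f | ∀ b ∈ F, f b = 0}
        zero_mem' := fun _ _ => rfl
        add_mem' := fun {f g} hf hg b hb => by
          rw [DMod.Dual.add_apply, hf b hb, hg b hb, add_zero]
        neg_mem' := fun {f} hf b hb => by
          change -(f b) = 0
          rw [hf b hb, neg_zero] }
    obtain ⟨n, hn, hna⟩ := A.exists_nsmul_eq_zero a
    obtain ⟨k, hk⟩ := UnitAddCircle.exists_eq_zsmul_of_ker_le hn (ev.comp K.subtype)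
      (χ.comp K.subtype) (fun f => by
        change n • f.1 a = 0
        rw [← map_nsmul, hna, map_zero]) (fun f hf => h f.1 fun b hb => by
        rcases Finset.mem_insert.1 hb with rfl | hb
        · exact hf
        · exact f.2 b hb)
    obtain ⟨b, hb⟩ := ih (χ - k • ev) fun f hf => by
      have := DFunLike.congr_fun hk (⟨f, hf⟩ : K)
      rw [AddMonoidHom.sub_apply, sub_eq_zero]
      exact this
    refine ⟨b + k • a, fun f => ?_⟩
    have := hb f
    rw [AddMonoidHom.sub_apply, sub_eq_iff_eq_add] at this
    rw [this, map_add, map_zsmul]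
    rfl

/-- Every continuous character of `A^∨` is an evaluation: it is trivial on a neighbourhood of zero,
hence on the characters killing some finite subset of `A`. -/
theorem DMod.Dual.exists_eq_eval [CompactSpace R] (A : DMod R)
    (χ : A.Dual →ₜ+ UnitAddCircle) : ∃ b : A.carrier, ∀ f : A.Dual, χ f = f b := by
  have h0 : {f : A.Dual | χ f = 0} ∈ 𝓝 (0 : A.Dual) := eventually_apply_eq_zero χ
  have hind : Topology.IsInducing fun (f : A.Dual) (a : A.carrier) => f a :=
    (ContinuousAddMonoidHom.isClosedEmbedding_coe
      (A := A.carrier) (B := UnitAddCircle)).isInducing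
  rw [hind.nhds_eq_comap, Filter.mem_comap] at h0
  obtain ⟨t, ht, hts⟩ := h0
  rw [nhds_pi, Filter.mem_pi] at ht
  obtain ⟨I, hI, s, hs, hIs⟩ := ht
  refine DMod.Dual.exists_eq_eval_of_finset A hI.toFinset (χ : A.Dual →+ UnitAddCircle)
    fun f hf => hts (hIs fun a ha => ?_)
  change f a ∈ s a
  rw [hf a (hI.mem_toFinset.2 ha)]
  exact mem_of_mem_nhds (hs a)

/-- The evaluation `A → A^∨∨`. -/
def DMod.eval [CompactSpace R] (A : DMod R) : A ⟶ dualP.obj (op (dualD.obj (op A))) where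
  lin :=
    { toFun := fun a => ContinuousAddMonoidHom.mk
        { toFun := fun f : A.Dual => f a, map_zero' := rfl, map_add' := fun _ _ => rfl }
        (continuous_eval_const (F := A.Dual) a)
      map_add' := fun a b => PMod.Dual.ext fun f : A.Dual => map_add f a b
      map_smul' := fun _ _ => rfl }

theorem DMod.eval_bijective [CompactSpace R] (A : DMod R) : Function.Bijective A.eval.lin := by
  constructor
  · rw [injective_iff_map_eq_zero]
    intro a ha
    by_contra hne
    obtain ⟨f, hf⟩ := DMod.Dual.exists_apply_ne_zero A hne
    exact hf (DFunLike.congr_fun (F := (dualD.obj (op A)).Dual) ha f)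
  · intro χ
    obtain ⟨b, hb⟩ := DMod.Dual.exists_eq_eval A χ
    exact ⟨b, PMod.Dual.ext fun f => (hb f).symm⟩

/-- The evaluation `M → M^∨∨`. -/
def PMod.eval [CompactSpace R] (M : PMod R) : M ⟶ dualD.obj (op (dualP.obj (op M))) where
  lin :=
    { toFun := fun a => ContinuousAddMonoidHom.mk
        { toFun := fun f : M.Dual => f a, map_zero' := rfl, map_add' := fun _ _ => rfl }
        continuous_of_discreteTopology
      map_add' := fun a b => DMod.Dual.ext fun f : M.Dual => map_add f a b
      map_smul' := fun _ _ => rfl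
      cont := DMod.Dual.continuous_iff.2 fun f : M.Dual => map_continuous f }

theorem PMod.eval_bijective [CompactSpace R] (M : PMod R) : Function.Bijective M.eval.lin := by
  constructor
  · rw [injective_iff_map_eq_zero]
    intro a ha
    by_contra hne
    obtain ⟨f, -, hf⟩ := exists_continuousAddMonoidHom_apply_ne_zero (⊥ : AddSubgroup M.carrier)
      isClosed_singleton hne
    exact hf (DFunLike.congr_fun (F := (dualP.obj (op M)).Dual) ha f)
  · intro ξ
    by_contra hξ
    -- a character `χ` vanishing on the closed image but not at `ξ` is evaluation at some `f ∈ M^∨`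
    obtain ⟨χ, hχ, hne⟩ := exists_continuousAddMonoidHom_apply_ne_zero
      (AddMonoidHomClass.toAddMonoidHom M.eval.lin).range
      (isCompact_range M.eval.lin.continuous).isClosed (g := ξ) hξ
    obtain ⟨f, hf⟩ := DMod.Dual.exists_eq_eval (dualP.obj (op M)) χ
    have hf0 : f = 0 := PMod.Dual.ext fun m => (hf (M.eval.lin m)).symm.trans (hχ _ ⟨m, rfl⟩)
    subst hf0
    exact hne ((hf ξ).trans (map_zero (show (dualP.obj (op M)).Dual from ξ)))

/-- Pontryagin duality `A ≅ A^∨∨` for discrete modules. -/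
def evalIsoD [CompactSpace R] : 𝟭 (DMod R) ≅ dualD.rightOp ⋙ dualP :=
  NatIso.ofComponents (fun A => DMod.isoOfBijective A.eval A.eval_bijective) fun _ => rfl

/-- Pontryagin duality `M ≅ M^∨∨` for profinite modules. -/
def evalIsoP [CompactSpace R] : 𝟭 (PMod R) ≅ dualP.rightOp ⋙ dualD :=
  NatIso.ofComponents (fun M => PMod.isoOfBijective M.eval M.eval_bijective) fun _ => rfl

end Duality

/-! ### Characters of `sheaves' of profinite modules and profinite direct sums -/

section Characters

variable {R : Type u} [Ring R] [TopologicalSpace R]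

namespace ProSheaf

variable (M : ProSheaf R)

theorem continuous_smul' {Y : Type*} [TopologicalSpace Y] {r : Y → R} {m : Y → Tot M.fib}
    (hr : Continuous r) (hm : Continuous m) :
    Continuous fun y => (⟨(m y).base, r y • (m y).val⟩ : Tot M.fib) :=
  M.continuous_smul.comp (hr.prodMk hm)

/-- The `R`-module of characters of a `sheaf' `M` of profinite modules: continuous maps from the
total space of `M` to `ℝ / ℤ` that are additive on fibres. -/
def charSubmodule : Submodule Rᵐᵒᵖ (∀ x, (M.fibre x).Dual) where
  carrier := {χ | Continuous fun m : Tot M.fib => χ m.base m.val}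
  add_mem' hχ hξ := Continuous.add hχ hξ
  zero_mem' := continuous_const (y := (0 : UnitAddCircle))
  smul_mem' r _ hχ := Continuous.comp hχ (M.continuous_smul' (continuous_const (y := r.unop))
    continuous_id)

variable {M} in
theorem continuous_char (χ : M.charSubmodule) : Continuous fun m : Tot M.fib => χ.1 m.base m.val :=
  χ.2

/-- A family of characters of the fibres that is continuous on the total space, as a character of
`M`. -/
def charMk (χ : ∀ x, M.fib x →+ UnitAddCircle)
    (h : Continuous fun m : Tot M.fib => χ m.base m.val) : M.charSubmodule :=
  ⟨fun x => ContinuousAddMonoidHom.mk (χ x) (h.comp (M.continuous_fibre_incl x)), h⟩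

/-- The discrete `R`-module of characters of a `sheaf' of profinite modules. The action of `R` is
continuous because the total space is compact and the circle has no small subgroups. -/
def chars [IsTopologicalRing R] : DMod R :=
  letI : TopologicalSpace M.charSubmodule := ⊥
  haveI : DiscreteTopology M.charSubmodule := ⟨rfl⟩
  { carrier := M.charSubmodule
    contSMul := ⟨by
      rw [continuous_prod_of_discrete_right]
      intro χ
      have hc : Continuous fun r : R => MulOpposite.op r • χ := by
        refine (IsLocallyConstant.iff_eventually_eq _).2 (fun r₀ => ?_) |>.continuous
        obtain ⟨V, hV, h0, hsmall⟩ := UnitAddCircle.exists_nhds_no_small_subgroups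
        have hcont : Continuous fun q : R × Tot M.fib => χ.1 q.2.base ((q.1 - r₀) • q.2.val) :=
          (continuous_char χ).comp (M.continuous_smul'
            (continuous_fst.sub (continuous_const (y := r₀))) continuous_snd)
        obtain ⟨u, v, hu, -, hru, hmv, huv⟩ := generalized_tube_lemma
          (isCompact_singleton (x := r₀)) (isCompact_univ (X := Tot M.fib)) (hV.preimage hcont) (by
            rintro ⟨r, m⟩ ⟨rfl, -⟩
            change χ.1 m.base ((r - r) • m.val) ∈ V
            rw [sub_self, zero_smul]
            exact (map_zero (χ.1 m.base)).symm ▸ h0)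
        filter_upwards [hu.mem_nhds (hru rfl)] with r hr
        refine Subtype.ext (funext fun x => PMod.Dual.ext fun m => ?_)
        change χ.1 x (r • m) = χ.1 x (r₀ • m)
        rw [← sub_eq_zero, ← map_sub, ← sub_smul]
        refine hsmall _ fun n => ?_
        rw [← map_nsmul, smul_comm]
        exact huv (Set.mk_mem_prod hr (hmv (Set.mem_univ ⟨x, n • m⟩)))
      exact hc.comp MulOpposite.continuous_unop⟩ }

variable {M}

/-- The restriction to a fibre of a map from a `sheaf' to a module, as a morphism of profinite
modules. -/
def MapTo.toFibre {P : PMod R} (b : M.MapTo P) (x : M.base) : M.fibre x ⟶ P :=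
  ⟨{ toLinearMap := b.toFun x
     cont := b.continuous_toFun.comp (M.continuous_fibre_incl x) }⟩

/-- The pullback of characters along a morphism of `sheaves'. -/
def charsMap [IsTopologicalRing R] {N : ProSheaf R} (g : N ⟶ M) : M.chars ⟶ N.chars where
  lin :=
    { toFun := fun χ => ⟨fun y => (dualP.map (fibreMap g y).op).lin (χ.1 (g.f y)),
        (continuous_char χ).comp g.continuous_ψ⟩
      map_add' := fun _ _ => rfl
      map_smul' := fun r χ => Subtype.ext (funext fun y =>
        (dualP.map (fibreMap g y).op).lin.map_smul r (χ.1 (g.f y))) }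

/-- The character `t ∘ b` of `M`, for a map `b` from `M` to a module `P` and a character `t` of
`P`. -/
def MapTo.charMap [IsTopologicalRing R] {P : PMod R} (b : M.MapTo P) :
    dualP.obj (op P) ⟶ M.chars where
  lin :=
    { toFun := fun t => ⟨fun x => (dualP.map (b.toFibre x).op).lin t,
        (map_continuous (show P.Dual from t)).comp b.continuous_toFun⟩
      map_add' := fun _ _ => rfl
      map_smul' := fun r t => Subtype.ext (funext fun x =>
        (dualP.map (b.toFibre x).op).lin.map_smul r t) }

theorem ProfiniteSum.map_apply (S : ∀ M : ProSheaf R, M.ProfiniteSum) {N M : ProSheaf R}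
    (g : N ⟶ M) (y : N.base) (n : N.fib y) :
    ((profiniteDirectSum S).map g).lin ((S N).ω.toFun y n) = (S M).ω.toFun (g.f y) (g.ψ y n) :=
  congrArg (fun b : N.MapTo (S M).sum => b.toFun y n) ((S N).comp_desc _)

/-- The pullback of characters of profinite direct sums corresponds to the pullback of characters
of `sheaves'. -/
theorem ProfiniteSum.charMap_map [IsTopologicalRing R] (S : ∀ M : ProSheaf R, M.ProfiniteSum)
    {N M : ProSheaf R} (g : N ⟶ M) (t : (S M).sum.Dual) :
    (S N).ω.charMap.lin ((dualP.map ((profiniteDirectSum S).map g).op).lin t) =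
      (charsMap g).lin ((S M).ω.charMap.lin t) :=
  Subtype.ext (funext fun y => PMod.Dual.ext fun n =>
    congrArg t (ProfiniteSum.map_apply S g y n))

variable (M)

/-- The evaluation of the characters of `M` at the points of `M`. -/
def evalChars [IsTopologicalRing R] [CompactSpace R] : M.MapTo (dualD.obj (op M.chars)) where
  toFun x :=
    { toFun := fun m => ContinuousAddMonoidHom.mk
        { toFun := fun χ : M.charSubmodule => χ.1 x m
          map_zero' := rfl
          map_add' := fun _ _ => rfl }
        continuous_of_discreteTopology
      map_add' := fun m n => DMod.Dual.ext fun χ : M.charSubmodule => map_add (χ.1 x) m n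
      map_smul' := fun _ _ => rfl }
  continuous_toFun := DMod.Dual.continuous_iff.2 fun χ : M.charSubmodule => continuous_char χ

variable [IsTopologicalRing R] [CompactSpace R]

/-- The dual of the module of characters of `M` is a profinite direct sum of `M`: a map `M → P`
induces `P^∨ → chars M`, hence `(chars M)^∨ → P^∨∨ ≅ P`. -/
def charsSum : M.ProfiniteSum where
  sum := dualD.obj (op M.chars)
  ω := M.evalChars
  universal P b := by
    refine ⟨dualD.map b.charMap.op ≫ evalIsoP.inv.app P, ?_, fun g hg => ?_⟩
    · refine MapTo.ext (funext fun x => LinearMap.ext fun m => ?_)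
      have h : (evalIsoP.inv.app P).lin (P.eval.lin (b.toFun x m)) = b.toFun x m :=
        congrArg (fun f : P ⟶ P => f.lin (b.toFun x m)) (evalIsoP.hom_inv_id_app P)
      exact h
    · rw [← cancel_mono (evalIsoP.hom.app P), Category.assoc, Iso.inv_hom_id_app]
      refine PMod.Hom.ext (ContinuousLinearMap.ext fun ξ => DMod.Dual.ext fun t : P.Dual => ?_)
      -- the character `t ∘ g` of `(chars M)^∨` is the evaluation at the character `t ∘ b` of `M`
      obtain ⟨χ, hχ⟩ := M.chars.eval_bijective.2 ((dualP.map g.op).lin t)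
      have hχ' : χ = b.charMap.lin t := by
        refine Subtype.ext (funext fun x => PMod.Dual.ext fun m => ?_)
        have h1 := DFunLike.congr_fun (F := (dualD.obj (op M.chars)).Dual) hχ
          (M.evalChars.toFun x m)
        refine h1.trans ?_
        subst hg
        rfl
      subst hχ'
      exact (DFunLike.congr_fun (F := (dualD.obj (op M.chars)).Dual) hχ ξ).symm

variable {M}

/-- The characters of a profinite direct sum of `M` are the characters of `M`. For `charsSum` this
is the duality `chars M ≅ (chars M)^∨∨`, and any two profinite direct sums are isomorphic. -/
theorem ProfiniteSum.charMap_bijective (S : M.ProfiniteSum) :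
    Function.Bijective S.ω.charMap.lin := by
  let C := M.charsSum
  have hC : Function.Injective C.ω.charMap.lin := by
    intro t t' h
    obtain ⟨χ, rfl⟩ := M.chars.eval_bijective.2 t
    obtain ⟨χ', rfl⟩ := M.chars.eval_bijective.2 t'
    exact congrArg _ h
  constructor
  · intro t t' h
    have hid : S.desc C.ω ≫ C.desc S.ω = 𝟙 S.sum := S.hom_ext (by
      change (S.ω.comp (S.desc C.ω)).comp (C.desc S.ω) = S.ω
      rw [S.comp_desc, C.comp_desc])
    have key : ∀ t : S.sum.Dual, C.ω.charMap.lin ((dualP.map (C.desc S.ω).op).lin t) =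
        S.ω.charMap.lin t := fun t => by
      conv_rhs => rw [← C.comp_desc S.ω]
      rfl
    have h2 : (dualP.map (C.desc S.ω).op).lin t = (dualP.map (C.desc S.ω).op).lin t' :=
      hC ((key t).trans (h.trans (key t').symm))
    have h3 : ∀ t : S.sum.Dual,
        (dualP.map (S.desc C.ω).op).lin ((dualP.map (C.desc S.ω).op).lin t) = t := fun t =>
      congrArg (fun f : S.sum ⟶ S.sum => (dualP.map f.op).lin t) hid
    exact (h3 t).symm.trans ((congrArg _ h2).trans (h3 t'))
  · intro χ
    refine ⟨(dualP.map (S.desc C.ω).op).lin (M.chars.eval.lin χ), ?_⟩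
    have key : ∀ t : C.sum.Dual, S.ω.charMap.lin ((dualP.map (S.desc C.ω).op).lin t) =
        C.ω.charMap.lin t := fun t => by
      conv_rhs => rw [← S.comp_desc C.ω]
      rfl
    exact key _

end ProSheaf

end Characters

/-! ### The fibres of the dual of a `sheaf' of profinite modules -/

section DualEtale

variable {R : Type u} [Ring R] [TopologicalSpace R]

namespace ProSheaf

variable (M : ProSheaf R)

variable {M} in
/-- A character of `M` that vanishes on the fibre over `x` vanishes on the fibres over a
neighbourhood of `x`: its values near that fibre are small, and the circle has no small
subgroups. -/
theorem eventually_char_eq_zero (χ : M.charSubmodule) {x : M.base}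
    (h : χ.1 x = 0) : ∀ᶠ y in 𝓝 x, χ.1 y = 0 := by
  obtain ⟨V, hV, h0, hsmall⟩ := UnitAddCircle.exists_nhds_no_small_subgroups
  have hcl : IsClosed (Tot.base '' {m : Tot M.fib | χ.1 m.base m.val ∉ V}) :=
    (((hV.preimage (continuous_char χ)).isClosed_compl.isCompact).image
      M.continuous_proj).isClosed
  have hx : x ∉ Tot.base '' {m : Tot M.fib | χ.1 m.base m.val ∉ V} := by
    rintro ⟨⟨y, m⟩, hm, rfl⟩
    refine hm ?_
    change χ.1 y m ∈ V
    rw [h]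
    exact h0
  filter_upwards [hcl.isOpen_compl.mem_nhds hx] with y hy
  refine PMod.Dual.ext fun m => hsmall _ fun n => ?_
  by_contra hn
  refine hy ⟨⟨y, n • m⟩, ?_, rfl⟩
  rwa [← map_nsmul] at hn

/-- The fibre product `M ×_X M` is compact. -/
theorem compactSpace_pair : @CompactSpace (Tot fun x => M.fib x × M.fib x) (pairTop M.fib) := by
  let _ := pairTop M.fib
  refine (profinite_of_closed_range
    (j := fun q : Tot fun x => M.fib x × M.fib x =>
      ((⟨q.base, q.val.1⟩ : Tot M.fib), (⟨q.base, q.val.2⟩ : Tot M.fib))) ⟨rfl⟩ ?_ ?_).1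
  · rintro ⟨x, m, n⟩ ⟨y, m', n'⟩ h
    obtain rfl : x = y := congrArg (fun p => p.1.base) h
    simpa using h
  · have h : Set.range (fun q : Tot fun x => M.fib x × M.fib x =>
        ((⟨q.base, q.val.1⟩ : Tot M.fib), (⟨q.base, q.val.2⟩ : Tot M.fib))) =
        {p | p.1.base = p.2.base} := by
      ext ⟨⟨x, m⟩, ⟨y, n⟩⟩
      constructor
      · rintro ⟨q, hq⟩
        exact (congrArg (fun p => p.1.base) hq).symm.trans (congrArg (fun p => p.2.base) hq)
      · intro hxy
        obtain rfl : x = y := hxy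
        exact ⟨⟨x, m, n⟩, rfl⟩
    rw [h]
    exact isClosed_eq (M.continuous_proj.comp continuous_fst)
      (M.continuous_proj.comp continuous_snd)

/-- A character of a fibre extends to the fibres over a clopen neighbourhood. It extends to a
continuous function on the total space with finitely many values, and the points of the base over
which this function is not additive form a closed set. -/
theorem exists_char_extension {x : M.base} (χ : (M.fibre x).Dual) :
    ∃ (U : Clopens M.base) (hx : x ∈ U) (g : (M.restrict U).charSubmodule),
      ∀ m : M.fib x, g.1 ⟨x, hx⟩ m = χ m := by
  have hfin : Finite (Set.range χ) := (finite_range_of_profinite χ).to_subtype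
  obtain ⟨k, hk, -, hkχ⟩ := Profinite.exists_lift_of_finite_of_injective_of_surjective
    (X := (M.fibre x).carrier) (Y := Tot M.fib) (S := Set.range χ) (T := Unit)
    (fun m => ⟨x, m⟩) (M.continuous_fibre_incl x)
    (fun m n h => eq_of_heq (Tot.mk.inj h).2)
    (fun _ => ()) (fun _ => ⟨⟨χ 0, 0, rfl⟩, rfl⟩) (fun m => ⟨χ m, m, rfl⟩)
    ((map_continuous χ).subtype_mk _) (fun _ => ()) continuous_const rfl
  have hkχ : ∀ m : M.fib x, (k ⟨x, m⟩ : UnitAddCircle) = χ m := fun m =>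
    congrArg Subtype.val (congrFun hkχ m)
  let _ := pairTop M.fib
  have := M.compactSpace_pair
  let B : Set (Tot fun x => M.fib x × M.fib x) :=
    {q | (k ⟨q.base, q.val.1 + q.val.2⟩ : UnitAddCircle) ≠
      k ⟨q.base, q.val.1⟩ + k ⟨q.base, q.val.2⟩}
  have hp := continuous_pairTop M.fib
  have hB : IsClosed B := by
    have hc : Continuous fun q : Tot fun x => M.fib x × M.fib x =>
        (k ⟨q.base, q.val.1 + q.val.2⟩, k ⟨q.base, q.val.1⟩, k ⟨q.base, q.val.2⟩) :=
      (hk.comp M.continuous_add).prodMk ((hk.comp (continuous_fst.comp hp)).prodMk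
        (hk.comp (continuous_snd.comp hp)))
    exact (isClosed_discrete {p : Set.range χ × Set.range χ × Set.range χ |
      (p.1 : UnitAddCircle) ≠ p.2.1 + p.2.2}).preimage hc
  have hcl : IsClosed (Tot.base '' B) :=
    (hB.isCompact.image ((M.continuous_proj.comp continuous_fst).comp hp)).isClosed
  have hx : x ∈ (Tot.base '' B)ᶜ := by
    rintro ⟨⟨y, m, n⟩, hm, rfl⟩
    refine hm ?_
    change (k ⟨y, m + n⟩ : UnitAddCircle) = k ⟨y, m⟩ + k ⟨y, n⟩
    rw [hkχ, hkχ, hkχ]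
    exact map_add χ m n
  obtain ⟨U, hU, hxU, hUB⟩ := compact_exists_isClopen_in_isOpen hcl.isOpen_compl hx
  have hadd : ∀ y ∈ U, ∀ m n : M.fib y, (k ⟨y, m + n⟩ : UnitAddCircle) =
      k ⟨y, m⟩ + k ⟨y, n⟩ := fun y hy m n => by
    by_contra h
    exact hUB hy ⟨⟨y, m, n⟩, h, rfl⟩
  have hc : Continuous fun m : Tot (M.restrict ⟨U, hU⟩).fib =>
      (k ⟨m.base.1, m.val⟩ : UnitAddCircle) :=
    continuous_subtype_val.comp (hk.comp (M.continuous_restrict_incl ⟨U, hU⟩))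
  exact ⟨⟨U, hU⟩, hxU, (M.restrict ⟨U, hU⟩).charMk (fun y => AddMonoidHom.mk'
    (fun m : M.fib y.1 => (k ⟨y.1, m⟩ : UnitAddCircle)) (hadd y.1 y.2)) hc, hkχ⟩

variable {M}

/-- The inclusion of the fibre over `x ∈ U` into a profinite direct sum of the restriction of `M`
to `U`. -/
def ProfiniteSum.fibreIncl {U : Clopens M.base} (S : (M.restrict U).ProfiniteSum) {x : M.base}
    (hx : x ∈ U) : M.fibre x ⟶ S.sum where
  lin :=
    { toLinearMap := S.ω.toFun ⟨x, hx⟩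
      cont := S.ω.continuous_toFun.comp (continuous_induced_rng.2 (M.continuous_fibre_incl x) :
        Continuous fun m : (M.fibre x).carrier =>
          (⟨⟨x, hx⟩, m⟩ : Tot (M.restrict U).fib)) }

end ProSheaf

theorem DPresheaf.germ_eq_zero (A : DPresheaf R) {x : A.base} {U V : Clopens A.base} (h : V ≤ U)
    (hx : x ∈ V) {s : (A.sh.obj (op U)).carrier} (hs : (A.res h).lin s = 0) :
    A.germ (h hx) s = 0 := by
  rw [← A.germ_res h hx, hs, map_zero]

namespace dualEtale

variable (S : ∀ M : ProSheaf R, M.ProfiniteSum) (M : ProSheaf R)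

/-- The presheaf `U ↦ (⊞ p⁻¹(U))^∨` of which the dual of `M` is the étale space. -/
abbrev presheaf : DPresheaf R := dualPrecosheaf.obj (op ((CoShf S).obj M))

variable {M}

/-- The value at the fibre over `x ∈ U` of a character of the profinite direct sum of `M` over
`U`. -/
def atFibre {x : M.base} {U : Clopens M.base} (hx : x ∈ U) :
    dualP.obj (op (S (M.restrict U)).sum) ⟶ dualP.obj (op (M.fibre x)) :=
  dualP.map ((S (M.restrict U)).fibreIncl hx).op

theorem atFibre_sumMap {N : ProSheaf R} (g : N ⟶ M) {V : Clopens N.base} {U : Clopens M.base}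
    (h : ∀ y ∈ V, g.f y ∈ U) {y : N.base} (hy : y ∈ V) (t : (S (M.restrict U)).sum.Dual) :
    (atFibre S hy).lin ((dualP.map (sumMap S g V U h).op).lin t) =
      (dualP.map (ProSheaf.fibreMap g y).op).lin ((atFibre S (h y hy)).lin t) :=
  PMod.Dual.ext fun n => congrArg t
    (ProSheaf.ProfiniteSum.map_apply S (ProSheaf.restrictMap g V U h) ⟨y, hy⟩ n)

variable (M)

theorem atFibre_nbhdMap (x : M.base) (U V : (presheaf S M).Nbhd x) (h : U ≤ V)
    (t : (presheaf S M).nbhdObj x U) :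
    (atFibre S (OrderDual.ofDual V).2).lin ((presheaf S M).nbhdMap x U V h t) =
      (atFibre S (OrderDual.ofDual U).2).lin t :=
  atFibre_sumMap S (𝟙 M) (fun _ hy => h hy) (OrderDual.ofDual V).2 t

open Classical in
/-- The map from the fibre of the dual of `M` to the dual of the fibre of `M`, sending the germ of a
character of `⊞ p⁻¹(U)` to its restriction to the fibre. -/
def fibreHom (x : M.base) : ((dualEtale S).obj (op M)).fibre x ⟶ dualP.obj (op (M.fibre x)) where
  lin := Module.DirectLimit.lift Rᵐᵒᵖ ((presheaf S M).Nbhd x) ((presheaf S M).nbhdObj x)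
    ((presheaf S M).nbhdMap x) (fun U => (atFibre S (OrderDual.ofDual U).2).lin)
    (atFibre_nbhdMap S M x)

variable {M}

theorem fibreHom_germ {x : M.base} {U : Clopens M.base} (hx : x ∈ U)
    (t : (S (M.restrict U)).sum.Dual) :
    (fibreHom S M x).lin ((presheaf S M).germ hx t) = (atFibre S hx).lin t := by
  classical
  exact Module.DirectLimit.lift_of (f := (presheaf S M).nbhdMap x)
    (i := OrderDual.toDual ⟨U, hx⟩) _ (atFibre_nbhdMap S M x) t

variable [IsTopologicalRing R] [CompactSpace R]

/-- The map to the dual of the fibre is injective because a character that vanishes on the fibre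
vanishes on the neighbouring fibres, and surjective because characters of the fibre extend. -/
theorem fibreHom_bijective (x : M.base) : Function.Bijective (fibreHom S M x).lin := by
  constructor
  · rw [injective_iff_map_eq_zero]
    intro a ha
    obtain ⟨U, hU, t, rfl⟩ := (presheaf S M).exists_germ a
    replace ha := (fibreHom_germ S hU t).symm.trans ha
    have hχ := ProSheaf.eventually_char_eq_zero ((S (M.restrict U)).ω.charMap.lin t)
      (x := (⟨x, hU⟩ : U)) (PMod.Dual.ext fun m =>
        DFunLike.congr_fun (F := (M.fibre x).Dual) ha m)
    have hχ' := U.isClopen.isOpen.isOpenEmbedding_subtypeVal.isOpenMap.image_mem_nhds hχ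
    obtain ⟨V, ⟨hxV, hV⟩, hVU⟩ := (nhds_basis_clopen x).mem_iff.1 hχ'
    have hle : (⟨V, hV⟩ : Clopens M.base) ≤ U := fun y hy => by
      obtain ⟨z, -, rfl⟩ := hVU hy
      exact z.2
    have hres : ((presheaf S M).res hle).lin t = 0 := by
      refine (S (M.restrict ⟨V, hV⟩)).charMap_bijective.1 ?_
      refine (ProSheaf.ProfiniteSum.charMap_map S (ProSheaf.restrictMap (𝟙 M) ⟨V, hV⟩ U
        fun _ hy => hle hy) t).trans (Eq.trans
          (Subtype.ext (funext fun y => PMod.Dual.ext fun m => ?_))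
          (map_zero (S (M.restrict ⟨V, hV⟩)).ω.charMap.lin).symm)
      obtain ⟨z, hz, hzy⟩ := hVU y.2
      obtain rfl : z = ⟨y.1, hle y.2⟩ := Subtype.ext hzy
      exact DFunLike.congr_fun (F := ((M.restrict U).fibre _).Dual) hz m
    exact (presheaf S M).germ_eq_zero hle hxV hres
  · intro χ
    obtain ⟨U, hx, g, hg⟩ := M.exists_char_extension χ
    obtain ⟨t, ht⟩ := (S (M.restrict U)).charMap_bijective.2 g
    refine ⟨(presheaf S M).germ hx t, (fibreHom_germ S hx t).trans (PMod.Dual.ext fun m => ?_)⟩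
    subst ht
    exact hg m

/-- The fibres of the dual of `M` are the duals of the fibres of `M`. -/
def fibreIso (M : ProSheaf R) (x : M.base) :
    ((dualEtale S).obj (op M)).fibre x ≅ dualP.obj (op (M.fibre x)) :=
  DMod.isoOfBijective (fibreHom S M x) (fibreHom_bijective S x)

theorem fibreIso_hom_germ {x : M.base} {U : Clopens M.base} (hx : x ∈ U)
    (t : (S (M.restrict U)).sum.Dual) :
    (fibreIso S M x).hom.lin ((presheaf S M).germ hx t) = (atFibre S hx).lin t :=
  fibreHom_germ S hx t

theorem fibreIso_naturality {N : ProSheaf R} (g : N ⟶ M) (y : N.base) :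
    EtaleSpace.fibreMap ((dualEtale S).map g.op) y ≫ (fibreIso S N y).hom =
      (fibreIso S M (g.f y)).hom ≫ dualP.map (ProSheaf.fibreMap g y).op := by
  refine DMod.Hom.ext (LinearMap.ext fun a => ?_)
  obtain ⟨U, hU, t, rfl⟩ := (presheaf S M).exists_germ a
  have h1 := DPresheaf.stalkMap_germ (dualPrecosheaf.map ((CoShf S).map g).op) hU t
  refine (congrArg (fibreIso S N y).hom.lin h1).trans ?_
  refine (fibreIso_hom_germ S _ _).trans ?_
  refine (atFibre_sumMap S g (V := clopenPreimage g.f U ⊓ ⊤) (U := U)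
    (fun _ hy => hy.1) ⟨hU, trivial⟩ t).trans ?_
  exact congrArg (dualP.map (ProSheaf.fibreMap g y).op).lin (fibreIso_hom_germ S hU t).symm

/-- The evaluation of points of the dual of `M` at points of `M` is continuous along continuous
families of both. -/
theorem continuous_pairing {Z : Type u} [TopologicalSpace Z] {m : Z → Tot M.fib}
    (hm : Continuous m) {s : ∀ z, (presheaf S M).stalk (m z).base}
    (hs : Continuous fun z => (⟨(m z).base, s z⟩ : Tot (presheaf S M).stalk)) :
    Continuous fun z => DFunLike.coe (F := (M.fibre (m z).base).Dual)
      ((fibreIso S M (m z).base).hom.lin (s z)) (m z).val := by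
  rw [continuous_iff_continuousAt]
  intro z
  obtain ⟨U, hU, t, ht⟩ : ∃ (U : Clopens M.base) (hU : (m z).base ∈ U)
      (t : (S (M.restrict U)).sum.Dual), (presheaf S M).germ hU t = s z :=
    (presheaf S M).exists_germ (s z)
  have hev : ∀ᶠ z' in 𝓝 z, (⟨(m z').base, s z'⟩ : Tot (presheaf S M).stalk) ∈
      (presheaf S M).germSet t :=
    hs.continuousAt ((presheaf S M).isOpen_germSet t |>.mem_nhds ⟨hU, ht.symm⟩)
  let O : Set Z :=
    {z' | (⟨(m z').base, s z'⟩ : Tot (presheaf S M).stalk) ∈ (presheaf S M).germSet t}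
  let F : Z → UnitAddCircle := fun z => DFunLike.coe (F := (M.fibre (m z).base).Dual)
    ((fibreIso S M (m z).base).hom.lin (s z)) (m z).val
  -- near `z` the function is `t ∘ ω ∘ m`
  let q : O → Tot (M.restrict U).fib := fun z' => ⟨⟨(m z'.1).base, z'.2.1⟩, (m z'.1).val⟩
  have hq : Continuous q := continuous_induced_rng.2 (hm.comp continuous_subtype_val)
  have hc : Continuous fun z' : O => t ((S (M.restrict U)).ω.toFun (q z').base (q z').val) :=
    (map_continuous t).comp ((S (M.restrict U)).ω.continuous_toFun.comp hq)
  have hF : ContinuousOn F O := by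
    rw [continuousOn_iff_continuous_domRestrict]
    refine hc.congr fun z' => ?_
    obtain ⟨h1, h2⟩ := z'.2
    exact DFunLike.congr_fun (F := (M.fibre (m z'.1).base).Dual)
      ((fibreIso_hom_germ S h1 t).symm.trans (congrArg _ h2.symm)) (m z'.1).val
  exact hF.continuousAt hev

end dualEtale

end DualEtale

/-! ### The fibres of the dual of an étale space -/

section DualSheaf

variable {R : Type u} [Ring R] [TopologicalSpace R]

namespace EtaleSpace

/-- Every point of an étale space lies on a section over a clopen set. -/
theorem exists_section (A : EtaleSpace R) {x : A.base} (a : A.fib x) :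
    ∃ (U : Clopens A.base) (hx : x ∈ U) (s : A.liftSubmodule (clopenIncl U)), s.1 ⟨x, hx⟩ = a := by
  obtain ⟨e, he, hbase⟩ := A.isLocalHomeomorph_proj ⟨x, a⟩
  have hbase : ∀ q, e q = q.base := fun q => congrFun hbase.symm q
  have hx : x ∈ e.target := by
    have := e.map_source he
    rwa [hbase] at this
  obtain ⟨U, hU, hxU, hUe⟩ := compact_exists_isClopen_in_isOpen e.open_target hx
  have hb : ∀ y ∈ U, (e.symm y).base = y := fun y hy => by
    rw [← hbase]
    exact e.right_inv (hUe hy)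
  have hval : ∀ (y : A.base) (q : Tot A.fib) (h : q.base = y),
      (⟨y, h ▸ q.val⟩ : Tot A.fib) = q := by
    rintro _ q rfl
    rfl
  let s : ∀ y : (⟨U, hU⟩ : Clopens A.base), A.fib y.1 := fun y => hb y.1 y.2 ▸ (e.symm y.1).val
  have hs : ∀ y : (⟨U, hU⟩ : Clopens A.base), (⟨y.1, s y⟩ : Tot A.fib) = e.symm y.1 := fun y =>
    hval _ _ (hb y.1 y.2)
  refine ⟨⟨U, hU⟩, hxU, ⟨s, ?_⟩, ?_⟩
  · have hc : Continuous fun y : (⟨U, hU⟩ : Clopens A.base) => e.symm y.1 :=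
      (e.continuousOn_symm.mono hUe).domRestrict
    exact hc.congr fun y => (hs y).symm
  · have h1 : (⟨x, s ⟨x, hxU⟩⟩ : Tot A.fib) = ⟨x, a⟩ := by
      refine (hs ⟨x, hxU⟩).trans ?_
      have := e.left_inv he
      rwa [hbase] at this
    exact eq_of_heq (Tot.mk.inj h1).2

end EtaleSpace

variable [CompactSpace R]

namespace dualSheaf

variable (A : EtaleSpace R)

/-- The precosheaf `U ↦ Γ(U, A)^∨` whose stalks form the dual of `A`. -/
abbrev precosheaf : PPrecosheaf R := dualPresheaf.obj (op (Shf.obj A))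

variable {A}

/-- The value at `x ∈ U` of a section over `U`. -/
def atPoint {x : A.base} {U : Clopens A.base} (hx : x ∈ U) :
    A.lifts (clopenIncl U) ⟶ A.fibre x where
  lin :=
    { toFun := fun s : A.liftSubmodule (clopenIncl U) => s.1 ⟨x, hx⟩
      map_add' := fun _ _ => rfl
      map_smul' := fun _ _ => rfl }

/-- The point of the dual of `A` over `x` given by a character `f` of `A_x`: the family of the
characters `s ↦ f (s x)` of the modules of sections over the neighbourhoods of `x`. -/
def ofFibre {x : A.base} (f : (A.fibre x).Dual) : (precosheaf A).stalk x :=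
  ⟨fun U => (dualD.map (atPoint U.2).op).lin f, fun _ _ _ => rfl⟩

theorem continuous_ofFibre (x : A.base) : Continuous fun f : (A.fibre x).Dual =>
    (⟨x, ofFibre f⟩ : (precosheaf A).TotStalk) := by
  refine (precosheaf A).continuous_totStalk (F := fun f : (A.fibre x).Dual => ⟨x, ofFibre f⟩)
    continuous_const fun U => ?_
  by_cases hx : x ∈ U
  · exact (dualD.map (atPoint hx).op).lin.continuous.congr fun f =>
      ((precosheaf A).extCor_of_mem (m := ⟨x, ofFibre f⟩) hx).symm
  · exact (continuous_const (y := 0)).congr fun f =>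
      ((precosheaf A).extCor_of_notMem (m := ⟨x, ofFibre f⟩) hx).symm

variable (A)

/-- The map `ofFibre` as a morphism of profinite modules from the dual of the fibre of `A` to the
fibre of the dual of `A`. -/
def fibreHom (x : A.base) : dualD.obj (op (A.fibre x)) ⟶ (dualSheaf.obj (op A)).fibre x where
  lin :=
    { toFun := ofFibre
      map_add' := fun _ _ => rfl
      map_smul' := fun r f => Subtype.ext (funext fun U =>
        (dualD.map (atPoint U.2).op).lin.map_smul r f)
      cont := continuous_induced_rng.2 (continuous_ofFibre x) }

variable {A}

theorem corAt_apply_res {x : A.base} {U V : Clopens A.base} (h : V ≤ U) (hx : x ∈ V)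
    (m : (precosheaf A).stalk x) (s : A.liftSubmodule (clopenIncl U)) :
    DFunLike.coe (F := (A.lifts (clopenIncl V)).Dual) ((precosheaf A).corAt hx m)
      ((sectionMap (𝟙 A) V U fun _ hy => h hy).lin s) =
    DFunLike.coe (F := (A.lifts (clopenIncl U)).Dual) ((precosheaf A).corAt (h hx) m) s :=
  DFunLike.congr_fun (F := (A.lifts (clopenIncl U)).Dual) ((precosheaf A).corAt_cor h hx m) s

/-- A point of the dual of `A` over `x` takes the same value on sections with the same value at
`x`, since these agree on a neighbourhood of `x`. -/
theorem corAt_apply_eq {x : A.base} (m : (precosheaf A).stalk x) {U V : Clopens A.base}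
    (hU : x ∈ U) (hV : x ∈ V) (s : A.liftSubmodule (clopenIncl U))
    (t : A.liftSubmodule (clopenIncl V)) (h : s.1 ⟨x, hU⟩ = t.1 ⟨x, hV⟩) :
    DFunLike.coe (F := (A.lifts (clopenIncl U)).Dual) ((precosheaf A).corAt hU m) s =
    DFunLike.coe (F := (A.lifts (clopenIncl V)).Dual) ((precosheaf A).corAt hV m) t := by
  have hs : Continuous fun y : (U ⊓ V : Clopens A.base) => (⟨y.1, s.1 ⟨y.1, y.2.1⟩⟩ : Tot A.fib) :=
    s.2.comp (continuous_subtype_val.subtype_mk fun y : (U ⊓ V : Clopens A.base) => y.2.1)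
  have ht : Continuous fun y : (U ⊓ V : Clopens A.base) => (⟨y.1, t.1 ⟨y.1, y.2.2⟩⟩ : Tot A.fib) :=
    t.2.comp (continuous_subtype_val.subtype_mk fun y : (U ⊓ V : Clopens A.base) => y.2.2)
  have ho := (U ⊓ V).isClopen.isOpen.isOpenEmbedding_subtypeVal.isOpenMap _
    (A.isOpen_eqLocus (f := fun y : (U ⊓ V : Clopens A.base) => y.1) hs ht)
  obtain ⟨W, hW, hxW, hWo⟩ := compact_exists_isClopen_in_isOpen ho ⟨⟨x, hU, hV⟩, h, rfl⟩
  have hWU : (⟨W, hW⟩ : Clopens A.base) ≤ U := fun y hy => by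
    obtain ⟨z, -, rfl⟩ := hWo hy
    exact z.2.1
  have hWV : (⟨W, hW⟩ : Clopens A.base) ≤ V := fun y hy => by
    obtain ⟨z, -, rfl⟩ := hWo hy
    exact z.2.2
  rw [← corAt_apply_res hWU hxW, ← corAt_apply_res hWV hxW]
  congr 1
  refine Subtype.ext (funext fun y => ?_)
  obtain ⟨z, hz, hzy⟩ := hWo y.2
  obtain rfl : z = ⟨y.1, hWU y.2, hWV y.2⟩ := Subtype.ext hzy
  exact hz

theorem corAt_apply_add {x : A.base} (m : (precosheaf A).stalk x) {U V W : Clopens A.base}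
    (hU : x ∈ U) (hV : x ∈ V) (hW : x ∈ W) (s : A.liftSubmodule (clopenIncl U))
    (t : A.liftSubmodule (clopenIncl V)) (r : A.liftSubmodule (clopenIncl W))
    {a b : A.fib x} (hs : s.1 ⟨x, hU⟩ = a) (ht : t.1 ⟨x, hV⟩ = b) (h : r.1 ⟨x, hW⟩ = a + b) :
    DFunLike.coe (F := (A.lifts (clopenIncl W)).Dual) ((precosheaf A).corAt hW m) r =
    DFunLike.coe (F := (A.lifts (clopenIncl U)).Dual) ((precosheaf A).corAt hU m) s +
    DFunLike.coe (F := (A.lifts (clopenIncl V)).Dual) ((precosheaf A).corAt hV m) t := by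
  have hm : x ∈ U ⊓ V := ⟨hU, hV⟩
  have hl : U ⊓ V ≤ U := inf_le_left
  have hr : U ⊓ V ≤ V := inf_le_right
  let F : (A.lifts (clopenIncl (U ⊓ V))).Dual := (precosheaf A).corAt hm m
  have h2 := map_add F ((sectionMap (𝟙 A) (U ⊓ V) U fun _ hy => hl hy).lin s)
    ((sectionMap (𝟙 A) (U ⊓ V) V fun _ hy => hr hy).lin t)
  rw [← corAt_apply_res hl hm, ← corAt_apply_res hr hm]
  refine Eq.trans ?_ h2
  exact corAt_apply_eq m hW hm r ((sectionMap (𝟙 A) (U ⊓ V) U fun _ hy => hl hy).lin s +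
    (sectionMap (𝟙 A) (U ⊓ V) V fun _ hy => hr hy).lin t)
    (h.trans (congrArg₂ (fun a b : A.fib x => a + b) hs ht).symm)

/-- The map from the dual of the fibre is injective because every point of `A_x` lies on a local
section. It is surjective because a compatible family of characters of the modules of sections
only depends on the values of the sections at `x`. -/
theorem fibreHom_bijective (x : A.base) : Function.Bijective (fibreHom A x).lin := by
  constructor
  · intro f f' h
    refine DMod.Dual.ext fun a : A.fib x => ?_
    obtain ⟨U, hx, s, rfl⟩ := A.exists_section a
    have h1 : (precosheaf A).corAt hx ((fibreHom A x).lin f) =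
        (precosheaf A).corAt hx ((fibreHom A x).lin f') := congrArg _ h
    exact DFunLike.congr_fun (F := (A.lifts (clopenIncl U)).Dual) h1 s
  · intro m
    choose U hx s hs using fun a : A.fib x => A.exists_section a
    let F : A.fib x → UnitAddCircle := fun a =>
      DFunLike.coe (F := (A.lifts (clopenIncl (U a))).Dual) ((precosheaf A).corAt (hx a) m) (s a)
    have hF : ∀ a b, F (a + b) = F a + F b := fun a b =>
      corAt_apply_add m (hx a) (hx b) (hx (a + b)) (s a) (s b) (s (a + b)) (hs a) (hs b)
        (hs (a + b))
    let f : (A.fibre x).Dual := ContinuousAddMonoidHom.mk (AddMonoidHom.mk' F hF)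
      continuous_of_discreteTopology
    refine ⟨f, (precosheaf A).stalk_ext fun V hV => DMod.Dual.ext
      fun t : A.liftSubmodule (clopenIncl V) => ?_⟩
    exact corAt_apply_eq m (hx (t.1 ⟨x, hV⟩)) hV (s (t.1 ⟨x, hV⟩)) t (hs (t.1 ⟨x, hV⟩))

/-- The fibres of the dual of `A` are the duals of the fibres of `A`. -/
def fibreIso (A : EtaleSpace R) (x : A.base) :
    (dualSheaf.obj (op A)).fibre x ≅ dualD.obj (op (A.fibre x)) :=
  (PMod.isoOfBijective (fibreHom A x) (fibreHom_bijective x)).symm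

theorem fibreIso_hom_ofFibre {x : A.base} (f : (A.fibre x).Dual) :
    (fibreIso A x).hom.lin (ofFibre f) = f :=
  congrArg (fun g : dualD.obj (op (A.fibre x)) ⟶ dualD.obj (op (A.fibre x)) => g.lin f)
    (fibreIso A x).inv_hom_id

theorem fibreIso_hom_apply {x : A.base} {U : Clopens A.base} (hx : x ∈ U)
    (m : (precosheaf A).stalk x) (s : A.liftSubmodule (clopenIncl U)) :
    DFunLike.coe (F := (A.fibre x).Dual) ((fibreIso A x).hom.lin m) (s.1 ⟨x, hx⟩) =
      DFunLike.coe (F := (A.lifts (clopenIncl U)).Dual) ((precosheaf A).corAt hx m) s := by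
  obtain ⟨f, rfl⟩ := (fibreHom_bijective x).2 m
  exact DFunLike.congr_fun (F := (A.fibre x).Dual) (fibreIso_hom_ofFibre f) (s.1 ⟨x, hx⟩)

theorem fibreIso_naturality {B : EtaleSpace R} (g : A ⟶ B) (y : B.base) :
    ProSheaf.fibreMap (dualSheaf.map g.op) y ≫ (fibreIso A (g.f y)).hom =
      (fibreIso B y).hom ≫ dualD.map (EtaleSpace.fibreMap g y).op := by
  refine PMod.Hom.ext (ContinuousLinearMap.ext fun m => ?_)
  obtain ⟨f, rfl⟩ := (fibreHom_bijective y).2 m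
  exact (fibreIso_hom_ofFibre ((dualD.map (EtaleSpace.fibreMap g y).op).lin f)).trans
    (congrArg (dualD.map (EtaleSpace.fibreMap g y).op).lin (fibreIso_hom_ofFibre f)).symm

/-- A section of `A` over `U` defines a continuous function on the part of the dual of `A` over
`U`. -/
theorem continuous_pairing {Z : Type u} [TopologicalSpace Z] {m : Z → (precosheaf A).TotStalk}
    (hm : Continuous m) {U : Clopens A.base} (s : A.liftSubmodule (clopenIncl U))
    (hU : ∀ z, (m z).base ∈ U) :
    Continuous fun z => DFunLike.coe (F := (A.fibre (m z).base).Dual)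
      ((fibreIso A (m z).base).hom.lin (m z).val) (s.1 ⟨(m z).base, hU z⟩) := by
  have h : Continuous fun z => DFunLike.coe (F := (A.lifts (clopenIncl U)).Dual)
      ((precosheaf A).extCor U (m z)) s :=
    (continuous_eval_const (F := (A.lifts (clopenIncl U)).Dual)
      (s : (A.lifts (clopenIncl U)).carrier)).comp (((precosheaf A).continuous_extCor U).comp hm)
  exact h.congr fun z => (congrArg (fun F : (A.lifts (clopenIncl U)).Dual => F s)
    ((precosheaf A).extCor_of_mem (hU z))).trans (fibreIso_hom_apply (hU z) _ s).symm

end dualSheaf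

end DualSheaf

/-! ### Double duals -/

/-- A fibrewise bijective continuous map between two étale spaces over the same base has a
continuous inverse, as it is a local homeomorphism. -/
theorem continuous_fibrewise_symm {X : Type u} [TopologicalSpace X] {F G : X → Type u}
    [TopologicalSpace (Tot F)] [TopologicalSpace (Tot G)]
    (hF : IsLocalHomeomorph (Tot.base : Tot F → X)) (hG : IsLocalHomeomorph (Tot.base : Tot G → X))
    (e : ∀ x, F x ≃ G x) (h : Continuous fun q : Tot F => (⟨q.base, e q.base q.val⟩ : Tot G)) :
    Continuous fun q : Tot G => (⟨q.base, (e q.base).symm q.val⟩ : Tot F) := by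
  let E : Tot F ≃ Tot G :=
    { toFun := fun q => ⟨q.base, e q.base q.val⟩
      invFun := fun q => ⟨q.base, (e q.base).symm q.val⟩
      left_inv := fun q => by simp
      right_inv := fun q => by simp }
  exact (E.toHomeomorphOfContinuousOpen h (IsLocalHomeomorph.of_comp (f := E)
    (show IsLocalHomeomorph (Tot.base ∘ E) from hF) hG h).isOpenMap).continuous_symm

/-- A fibrewise bijective continuous map between profinite spaces has a continuous inverse. -/
theorem continuous_fibrewise_symm_of_compact {X : Type u} {F G : X → Type u}
    [TopologicalSpace (Tot F)] [TopologicalSpace (Tot G)] [CompactSpace (Tot F)] [T2Space (Tot G)]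
    (e : ∀ x, F x ≃ G x) (h : Continuous fun q : Tot F => (⟨q.base, e q.base q.val⟩ : Tot G)) :
    Continuous fun q : Tot G => (⟨q.base, (e q.base).symm q.val⟩ : Tot F) := by
  let E : Tot F ≃ Tot G :=
    { toFun := fun q => ⟨q.base, e q.base q.val⟩
      invFun := fun q => ⟨q.base, (e q.base).symm q.val⟩
      left_inv := fun q => by simp
      right_inv := fun q => by simp }
  exact Continuous.continuous_symm_of_equiv_compact_to_t2 (f := E) h

section Bidual

variable {R : Type u} [Ring R] [TopologicalSpace R] [IsTopologicalRing R] [CompactSpace R]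
  (S : ∀ M : ProSheaf R, M.ProfiniteSum)

namespace EtaleSpace

/-- The double dual of an étale space. -/
abbrev bidual (A : EtaleSpace R) : EtaleSpace R :=
  (dualEtale S).obj (op (dualSheaf.obj (op A)))

/-- The isomorphism of the fibres of an étale space with those of its double dual. -/
def bidualFibreIso (A : EtaleSpace R) (x : A.base) : A.fibre x ≅ (A.bidual S).fibre x :=
  evalIsoD.app (A.fibre x) ≪≫ dualP.mapIso (dualSheaf.fibreIso A x).op ≪≫
    (dualEtale.fibreIso S (dualSheaf.obj (op A)) x).symm

variable {A B : EtaleSpace R}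

/-- The defining property of the map to the double dual: it is evaluation, after the identification
of the fibres with their double duals. -/
theorem bidualFibreIso_apply {x : A.base} (a : A.fib x) (m : (dualSheaf.precosheaf A).stalk x) :
    DFunLike.coe (F := ((dualSheaf.obj (op A)).fibre x).Dual)
      ((dualEtale.fibreIso S (dualSheaf.obj (op A)) x).hom.lin
        ((bidualFibreIso S A x).hom.lin a)) m =
      DFunLike.coe (F := (A.fibre x).Dual) ((dualSheaf.fibreIso A x).hom.lin m) a :=
  DFunLike.congr_fun (F := ((dualSheaf.obj (op A)).fibre x).Dual)
    (congrArg (fun f => f.lin ((dualP.map (dualSheaf.fibreIso A x).hom.op).lin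
      ((A.fibre x).eval.lin a))) (dualEtale.fibreIso S (dualSheaf.obj (op A)) x).inv_hom_id) m

theorem bidualFibreIso_naturality (g : A ⟶ B) (y : B.base) :
    fibreMap g y ≫ (bidualFibreIso S B y).hom =
      (bidualFibreIso S A (g.f y)).hom ≫
        fibreMap ((dualEtale S).map (dualSheaf.map g.op).op) y := by
  refine DMod.Hom.ext (LinearMap.ext fun a => ?_)
  refine (DMod.iso_bijective (dualEtale.fibreIso S (dualSheaf.obj (op B)) y)).1
    (PMod.Dual.ext fun m => ?_)
  have h1 := congrArg (fun f => f.lin ((bidualFibreIso S A (g.f y)).hom.lin a))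
    (dualEtale.fibreIso_naturality S (dualSheaf.map g.op) y)
  have h2 := congrArg (fun f => f.lin m) (dualSheaf.fibreIso_naturality g y)
  refine (bidualFibreIso_apply S (g.φ y a) m).trans ?_
  refine Eq.trans ?_ (DFunLike.congr_fun (F := ((dualSheaf.obj (op B)).fibre y).Dual) h1 m).symm
  refine Eq.trans ?_ (bidualFibreIso_apply S a
    ((ProSheaf.fibreMap (dualSheaf.map g.op) y).lin m)).symm
  exact (DFunLike.congr_fun (F := (A.fibre (g.f y)).Dual) h2 a).symm

/-- The character of the part of the dual of `A` over `U` given by a section over `U`. -/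
def sectionChar {U : Clopens A.base} (s : A.liftSubmodule (clopenIncl U)) :
    (ProSheaf.restrict (dualSheaf.obj (op A)) U).charSubmodule :=
  ProSheaf.charMk _ (fun y => AddMonoidHomClass.toAddMonoidHom
    (show ((dualSheaf.obj (op A)).fibre y.1).Dual from
      (dualP.map (dualSheaf.fibreIso A y.1).hom.op).lin ((A.fibre y.1).eval.lin (s.1 y))))
    (dualSheaf.continuous_pairing (ProSheaf.continuous_restrict_incl (dualSheaf.obj (op A)) U) s
      fun m => m.base.2)

variable (A)

/-- The map to the double dual is continuous: it sends a section over `U` to the germs of the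
corresponding character of the part of the dual over `U`. -/
theorem continuous_bidual : Continuous fun q : Tot A.fib =>
    (⟨q.base, (bidualFibreIso S A q.base).hom.lin q.val⟩ : Tot (A.bidual S).fib) := by
  refine (dualEtale.presheaf S (dualSheaf.obj (op A))).continuous_of_germ
    (F := fun q : Tot A.fib => ⟨q.base, (bidualFibreIso S A q.base).hom.lin q.val⟩)
    A.isLocalHomeomorph_proj.continuous fun q => ?_
  obtain ⟨U, hU, s, hs⟩ := A.exists_section q.val
  obtain ⟨t, ht⟩ := (S ((dualSheaf.obj (op A)).restrict U)).charMap_bijective.2 (sectionChar s)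
  refine ⟨U, t, ?_⟩
  let O : Set (Tot A.fib) := {q | q.base ∈ U}
  have hO : IsOpen O := U.isClopen.isOpen.preimage A.isLocalHomeomorph_proj.continuous
  have hc : Continuous fun q : O => (⟨q.1.base, s.1 ⟨q.1.base, q.2⟩⟩ : Tot A.fib) :=
    s.2.comp ((A.isLocalHomeomorph_proj.continuous.comp continuous_subtype_val).subtype_mk _)
  have ho := A.isOpen_eqLocus (f := fun q : O => q.1.base) (s := fun q => q.1.val)
    continuous_subtype_val hc
  have hn := hO.isOpenEmbedding_subtypeVal.isOpenMap.image_mem_nhds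
    (ho.mem_nhds (x := ⟨q, hU⟩) hs.symm)
  filter_upwards [hn]
  rintro _ ⟨⟨q, hq⟩, he, rfl⟩
  refine ⟨hq, (DMod.iso_bijective (dualEtale.fibreIso S (dualSheaf.obj (op A)) q.base)).1
    (PMod.Dual.ext fun m => ?_)⟩
  refine (bidualFibreIso_apply S q.val m).trans ?_
  refine Eq.trans ?_ (DFunLike.congr_fun (F := ((dualSheaf.obj (op A)).fibre q.base).Dual)
    (dualEtale.fibreIso_hom_germ S hq t) m).symm
  refine (congrArg (DFunLike.coe (F := (A.fibre q.base).Dual)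
    ((dualSheaf.fibreIso A q.base).hom.lin m)) he).trans ?_
  exact (congrArg (fun χ : (ProSheaf.restrict (dualSheaf.obj (op A)) U).charSubmodule =>
    χ.1 ⟨q.base, hq⟩ m) ht).symm

theorem continuous_bidual_symm : Continuous fun q : Tot (A.bidual S).fib =>
    (⟨q.base, (bidualFibreIso S A q.base).inv.lin q.val⟩ : Tot A.fib) :=
  @continuous_fibrewise_symm A.base _ A.fib (A.bidual S).fib A.top (A.bidual S).top
    A.isLocalHomeomorph_proj (A.bidual S).isLocalHomeomorph_proj
    (fun x => DMod.isoEquiv (bidualFibreIso S A x)) (continuous_bidual S A)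

/-- An étale space is isomorphic to its double dual. -/
def bidualIso : A ≅ A.bidual S where
  hom :=
    { f := ContinuousMap.id A.base
      φ := fun x => (bidualFibreIso S A x).hom.lin
      continuous_φ := @Continuous.comp _ _ _ (pullbackTop A.fib (ContinuousMap.id A.base)) _ _ _ _
        (continuous_bidual S A) (continuous_pullbackTop_fst A.fib (ContinuousMap.id A.base)) }
  inv :=
    { f := ContinuousMap.id A.base
      φ := fun x => (bidualFibreIso S A x).inv.lin
      continuous_φ := @Continuous.comp _ _ _
        (pullbackTop (A.bidual S).fib (ContinuousMap.id A.base)) _ _ _ _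
        (continuous_bidual_symm S A)
        (continuous_pullbackTop_fst (A.bidual S).fib (ContinuousMap.id A.base)) }
  hom_inv_id := EtaleSpace.Hom.ext rfl (heq_of_eq (funext fun x =>
    congrArg DMod.Hom.lin (bidualFibreIso S A x).hom_inv_id))
  inv_hom_id := EtaleSpace.Hom.ext rfl (heq_of_eq (funext fun x =>
    congrArg DMod.Hom.lin (bidualFibreIso S A x).inv_hom_id))

/-- Étale spaces are naturally isomorphic to their double duals. -/
def bidualNatIso : 𝟭 (EtaleSpace R) ≅ dualSheaf.rightOp ⋙ dualEtale S :=
  NatIso.ofComponents (bidualIso S) fun g => EtaleSpace.Hom.ext rfl (heq_of_eq (funext fun y =>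
    congrArg DMod.Hom.lin (bidualFibreIso_naturality S g y)))

end EtaleSpace

namespace ProSheaf

/-- The double dual of a `sheaf' of profinite modules. -/
abbrev bidual (M : ProSheaf R) : ProSheaf R := dualSheaf.obj (op ((dualEtale S).obj (op M)))

/-- The isomorphism of the fibres of a `sheaf' of profinite modules with those of its double
dual. -/
def bidualFibreIso (M : ProSheaf R) (x : M.base) : M.fibre x ≅ (M.bidual S).fibre x :=
  evalIsoP.app (M.fibre x) ≪≫ dualD.mapIso (dualEtale.fibreIso S M x).op ≪≫
    (dualSheaf.fibreIso ((dualEtale S).obj (op M)) x).symm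

variable {M N : ProSheaf R}

/-- The defining property of the map to the double dual: it is evaluation, after the identification
of the fibres with their double duals. -/
theorem bidualFibreIso_apply {x : M.base} (m : M.fib x) (a : (dualEtale.presheaf S M).stalk x) :
    DFunLike.coe (F := (((dualEtale S).obj (op M)).fibre x).Dual)
      ((dualSheaf.fibreIso ((dualEtale S).obj (op M)) x).hom.lin
        ((bidualFibreIso S M x).hom.lin m)) a =
      DFunLike.coe (F := (M.fibre x).Dual) ((dualEtale.fibreIso S M x).hom.lin a) m :=
  DFunLike.congr_fun (F := (((dualEtale S).obj (op M)).fibre x).Dual)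
    (congrArg (fun f => f.lin ((dualD.map (dualEtale.fibreIso S M x).hom.op).lin
      ((M.fibre x).eval.lin m))) (dualSheaf.fibreIso ((dualEtale S).obj (op M)) x).inv_hom_id) a

theorem bidualFibreIso_naturality (g : N ⟶ M) (y : N.base) :
    fibreMap g y ≫ (bidualFibreIso S M (g.f y)).hom =
      (bidualFibreIso S N y).hom ≫ fibreMap (dualSheaf.map ((dualEtale S).map g.op).op) y := by
  refine PMod.Hom.ext (ContinuousLinearMap.ext fun n => ?_)
  refine (PMod.iso_bijective (dualSheaf.fibreIso ((dualEtale S).obj (op M)) (g.f y))).1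
    (DMod.Dual.ext fun a => ?_)
  have h1 := congrArg (fun f => f.lin ((bidualFibreIso S N y).hom.lin n))
    (dualSheaf.fibreIso_naturality ((dualEtale S).map g.op) y)
  have h2 := congrArg (fun f => f.lin a) (dualEtale.fibreIso_naturality S g y)
  refine (bidualFibreIso_apply S (g.ψ y n) a).trans ?_
  refine Eq.trans ?_ (DFunLike.congr_fun
    (F := (((dualEtale S).obj (op M)).fibre (g.f y)).Dual) h1 a).symm
  refine Eq.trans ?_ (bidualFibreIso_apply S n
    ((EtaleSpace.fibreMap ((dualEtale S).map g.op) y).lin a)).symm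
  exact (DFunLike.congr_fun (F := (N.fibre y).Dual) h2 n).symm

variable (M)

/-- The map to the double dual is continuous, because the sections of the dual of `M` are
continuous as functions on the total space of `M`. -/
theorem continuous_bidual : Continuous fun q : Tot M.fib =>
    (⟨q.base, (bidualFibreIso S M q.base).hom.lin q.val⟩ : Tot (M.bidual S).fib) := by
  let D : EtaleSpace R := (dualEtale S).obj (op M)
  let F : Tot M.fib → (dualSheaf.precosheaf D).TotStalk := fun q =>
    ⟨q.base, (bidualFibreIso S M q.base).hom.lin q.val⟩
  refine (dualSheaf.precosheaf D).continuous_totStalk (F := F) M.continuous_proj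
    fun U : Clopens M.base =>
    DMod.Dual.continuous_iff.2 fun s : D.liftSubmodule (clopenIncl U) => ?_
  let φ : Tot M.fib → UnitAddCircle := fun q =>
    DFunLike.coe (F := (D.lifts (clopenIncl U)).Dual) ((dualSheaf.precosheaf D).extCor U (F q)) s
  let O : Set (Tot M.fib) := Tot.base ⁻¹' (U : Set M.base)
  have hO : IsClopen O := U.isClopen.preimage M.continuous_proj
  have h1 : ContinuousOn φ O := by
    rw [continuousOn_iff_continuous_domRestrict]
    have hs : Continuous fun q : O =>
        (⟨q.1.base, s.1 ⟨q.1.base, q.2⟩⟩ : Tot (dualEtale.presheaf S M).stalk) :=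
      s.2.comp ((M.continuous_proj.comp continuous_subtype_val).subtype_mk _)
    refine (dualEtale.continuous_pairing S (m := fun q : O => q.1) continuous_subtype_val
      hs).congr fun q => ?_
    refine (bidualFibreIso_apply S q.1.val _).symm.trans ?_
    refine (dualSheaf.fibreIso_hom_apply (A := D) q.2 _ s).trans ?_
    exact congrArg (fun f : (D.lifts (clopenIncl U)).Dual => f s)
      ((dualSheaf.precosheaf D).extCor_of_mem (m := F q.1) q.2).symm
  have h2 : ContinuousOn φ Oᶜ := (continuousOn_const (c := 0)).congr fun q hq =>
    congrArg (fun f : (D.lifts (clopenIncl U)).Dual => f s)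
      ((dualSheaf.precosheaf D).extCor_of_notMem (m := F q) hq)
  rw [continuous_iff_continuousAt]
  intro q
  by_cases hq : q ∈ O
  · exact h1.continuousAt (hO.isOpen.mem_nhds hq)
  · exact h2.continuousAt (hO.compl.isOpen.mem_nhds hq)

theorem continuous_bidual_symm : Continuous fun q : Tot (M.bidual S).fib =>
    (⟨q.base, (bidualFibreIso S M q.base).inv.lin q.val⟩ : Tot M.fib) :=
  @continuous_fibrewise_symm_of_compact M.base M.fib (M.bidual S).fib M.top (M.bidual S).top
    M.compact (M.bidual S).t2 (fun x => PMod.isoEquiv (bidualFibreIso S M x))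
    (continuous_bidual S M)

/-- A `sheaf' of profinite modules is isomorphic to its double dual. -/
def bidualIso : M ≅ M.bidual S where
  hom :=
    { f := ContinuousMap.id M.base
      ψ := fun x => ((bidualFibreIso S M x).hom.lin :
        (M.fibre x).carrier →ₗ[R] ((M.bidual S).fibre x).carrier)
      continuous_ψ := continuous_bidual S M }
  inv :=
    { f := ContinuousMap.id M.base
      ψ := fun x => ((bidualFibreIso S M x).inv.lin :
        ((M.bidual S).fibre x).carrier →ₗ[R] (M.fibre x).carrier)
      continuous_ψ := continuous_bidual_symm S M }
  hom_inv_id := ProSheaf.Hom.ext rfl (heq_of_eq (funext fun x => LinearMap.ext fun m =>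
    (PMod.isoEquiv (bidualFibreIso S M x)).symm_apply_apply m))
  inv_hom_id := ProSheaf.Hom.ext rfl (heq_of_eq (funext fun x => LinearMap.ext fun m =>
    (PMod.isoEquiv (bidualFibreIso S M x)).apply_symm_apply m))

/-- `Sheaves' of profinite modules are naturally isomorphic to their double duals. -/
def bidualNatIso : 𝟭 (ProSheaf R) ≅ (dualEtale S).rightOp ⋙ dualSheaf :=
  NatIso.ofComponents (bidualIso S) fun g => ProSheaf.Hom.ext rfl (heq_of_eq (funext fun y =>
    LinearMap.ext fun m => congrArg (fun f => f.lin m) (bidualFibreIso_naturality S g y)))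

end ProSheaf

/-- The dual functors form an equivalence of categories. -/
def dualEquivalence : (EtaleSpace R)ᵒᵖ ≌ ProSheaf R :=
  CategoryTheory.Equivalence.mk dualSheaf (dualEtale S).rightOp
    (NatIso.ofComponents (fun A => (EtaleSpace.bidualIso S A.unop).symm.op) fun g =>
      congrArg Quiver.Hom.op ((EtaleSpace.bidualNatIso S).inv.naturality g.unop).symm)
    (ProSheaf.bidualNatIso S).symm

end Bidual

/-! ### Profinite direct sums and continuous products -/

section Sums

variable {R : Type u} [Ring R] [TopologicalSpace R] [IsTopologicalRing R]

/-- The contravariant functor of characters of `sheaves' of profinite modules. -/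
def charsFunctor : (ProSheaf R)ᵒᵖ ⥤ DMod R where
  obj M := M.unop.chars
  map g := ProSheaf.charsMap g.unop

variable [CompactSpace R] (S : ∀ M : ProSheaf R, M.ProfiniteSum)

/-- The characters of the profinite direct sum of `M` are the characters of `M`. -/
def dualSumIso : (profiniteDirectSum S).op ⋙ dualP ≅ charsFunctor :=
  NatIso.ofComponents
    (fun M => DMod.isoOfBijective (S M.unop).ω.charMap (S M.unop).charMap_bijective)
    fun g => DMod.Hom.ext (LinearMap.ext fun t => ProSheaf.ProfiniteSum.charMap_map S g.unop t)

namespace dualEtale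

/-- A global section of the dual of `M` is a character of `M`. -/
def sectionsHom (M : ProSheaf R) : ((dualEtale S).obj (op M)).globalSections ⟶ M.chars where
  lin :=
    { toFun := fun s : ((dualEtale S).obj (op M)).liftSubmodule (ContinuousMap.id M.base) =>
        ⟨fun x => (fibreIso S M x).hom.lin (s.1 x), continuous_pairing S (m := fun m => m)
          continuous_id (s := fun m => s.1 m.base) (s.2.comp M.continuous_proj)⟩
      map_add' := fun s t => Subtype.ext (funext fun x =>
        map_add (fibreIso S M x).hom.lin (s.1 x) (t.1 x))
      map_smul' := fun r s => Subtype.ext (funext fun x =>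
        map_smul (fibreIso S M x).hom.lin r (s.1 x)) }

theorem sectionsHom_bijective (M : ProSheaf R) : Function.Bijective (sectionsHom S M).lin := by
  constructor
  · intro s t h
    refine Subtype.ext (funext fun x => (DMod.iso_bijective (fibreIso S M x)).1 ?_)
    exact congrFun (congrArg Subtype.val h) x
  · intro χ
    -- the section is given by the germs of the character of `⊞ p⁻¹(X)` corresponding to `χ`
    obtain ⟨t, ht⟩ := (S (M.restrict ⊤)).charMap_bijective.2
      ((M.restrict ⊤).charMk (fun x => AddMonoidHomClass.toAddMonoidHom (χ.1 x.1))
        ((ProSheaf.continuous_char χ).comp (M.continuous_restrict_incl ⊤)))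
    let s : ∀ x : M.base, (presheaf S M).stalk x := fun x => (presheaf S M).germ (U := ⊤) trivial t
    have hs : Continuous fun x : M.base => (⟨x, s x⟩ : Tot (presheaf S M).stalk) :=
      (presheaf S M).continuous_of_germ (F := fun x : M.base => ⟨x, s x⟩) continuous_id fun x =>
        ⟨⊤, t, Filter.Eventually.of_forall fun y => ⟨trivial, rfl⟩⟩
    refine ⟨⟨s, hs⟩, Subtype.ext (funext fun x => ?_)⟩
    refine (fibreIso_hom_germ S (U := ⊤) trivial t).trans (PMod.Dual.ext fun m => ?_)
    exact congrArg (fun χ : (M.restrict ⊤).charSubmodule => χ.1 ⟨x, trivial⟩ m) ht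

/-- The global sections of the dual of `M` are the characters of `M`. -/
def sectionsIso : dualEtale S ⋙ continuousProduct ≅ charsFunctor :=
  NatIso.ofComponents
    (fun M => DMod.isoOfBijective (sectionsHom S M.unop) (sectionsHom_bijective S M.unop))
    fun g => DMod.Hom.ext (LinearMap.ext fun s => Subtype.ext (funext fun y =>
      congrArg (fun f => f.lin (s.1 (g.unop.f y))) (fibreIso_naturality S g.unop y)))

/-- The global sections of the dual of `M` form the dual of the profinite direct sum of `M`. -/
def continuousProductIso : dualEtale S ⋙ continuousProduct ≅ (profiniteDirectSum S).op ⋙ dualP :=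
  sectionsIso S ≪≫ (dualSumIso S).symm

end dualEtale

/-- The profinite direct sum of the dual of `A` is the dual of the global sections of `A`: both are
dual to the global sections of the double dual of `A`. -/
def dualSheaf.directSumIso :
    dualSheaf ⋙ profiniteDirectSum S ≅ continuousProduct.op ⋙ dualD (R := R) :=
  NatIso.ofComponents
    (fun A => evalIsoP.app ((profiniteDirectSum S).obj (dualSheaf.obj A)) ≪≫
      dualD.mapIso ((dualEtale.continuousProductIso S).app (op (dualSheaf.obj A))).op ≪≫
      dualD.mapIso (continuousProduct.mapIso ((EtaleSpace.bidualNatIso S).app A.unop)).op)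
    fun {A B} g => by
      refine PMod.Hom.ext (ContinuousLinearMap.ext fun m => DMod.Dual.ext
        fun s : B.unop.globalSections.carrier => ?_)
      have h1 := congrArg (fun f => (continuousProduct.map f).lin s)
        ((EtaleSpace.bidualNatIso S).hom.naturality g.unop)
      have h2 := congrArg (fun f => f.lin
          ((continuousProduct.map ((EtaleSpace.bidualNatIso S).hom.app B.unop)).lin s))
        ((dualEtale.continuousProductIso S).hom.naturality (dualSheaf.map g).op)
      have h3 := (congrArg ((dualEtale.continuousProductIso S).hom.app
        (op (dualSheaf.obj A))).lin h1).trans h2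
      exact (DFunLike.congr_fun
        (F := ((profiniteDirectSum S).obj (dualSheaf.obj A)).Dual) h3 m).symm

end Sums

end

theorem mainTheorem1 (R : Type u) [Ring R] [TopologicalSpace R] [IsTopologicalRing R]
    [CompactSpace R] [T2Space R] [TotallyDisconnectedSpace R] :
    -- profinite direct sums exist
    (∀ M : ProSheaf R, Nonempty M.ProfiniteSum) ∧
    ∀ S : ∀ M : ProSheaf R, M.ProfiniteSum,
      -- the two dual functors are mutually inverse equivalences
      (∃ e : (EtaleSpace R)ᵒᵖ ≌ ProSheaf R,
        e.functor = dualSheaf ∧ e.inverse = (dualEtale S).rightOp) ∧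
      -- natural isomorphisms of the fibres of the dual of `A` with the duals of the fibres of `A`
      (∃ η : ∀ (A : EtaleSpace R) (x : A.base),
          (dualSheaf.obj (op A)).fibre x ≅ dualD.obj (op (A.fibre x)),
        ∀ (A B : EtaleSpace R) (g : A ⟶ B) (y : B.base),
          ProSheaf.fibreMap (dualSheaf.map g.op) y ≫ (η A (g.f y)).hom =
            (η B y).hom ≫ dualD.map (EtaleSpace.fibreMap g y).op) ∧
      -- natural isomorphisms of the fibres of the dual of `M` with the duals of the fibres of `M`
      (∃ η : ∀ (M : ProSheaf R) (x : M.base),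
          ((dualEtale S).obj (op M)).fibre x ≅ dualP.obj (op (M.fibre x)),
        ∀ (N M : ProSheaf R) (g : N ⟶ M) (y : N.base),
          EtaleSpace.fibreMap ((dualEtale S).map g.op) y ≫ (η N y).hom =
            (η M (g.f y)).hom ≫ dualP.map (ProSheaf.fibreMap g y).op) ∧
      -- the profinite direct sum of the dual of `A` is dual to the continuous product of `A`
      Nonempty (dualSheaf ⋙ profiniteDirectSum S ≅ continuousProduct.op ⋙ dualD (R := R)) ∧
      -- the continuous product of the dual of `M` is dual to the profinite direct sum of `M`
      Nonempty (dualEtale S ⋙ continuousProduct ≅ (profiniteDirectSum S).op ⋙ dualP) :=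
  ⟨fun M => ⟨M.charsSum⟩, fun S =>
    ⟨⟨dualEquivalence S, rfl, rfl⟩,
      ⟨dualSheaf.fibreIso, fun _ _ g y => dualSheaf.fibreIso_naturality g y⟩,
      ⟨dualEtale.fibreIso S, fun _ _ g y => dualEtale.fibreIso_naturality S g y⟩,
      ⟨dualSheaf.directSumIso S⟩, ⟨dualEtale.continuousProductIso S⟩⟩⟩
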